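/- Let $k$ be a field of characteristic different from $2$, let $m,n\ge 0$ be integers, let $\lambda$ be a partition, and put $d=|\lambda|$. Let $M=k^{m|n}$ be the vector superspace with even basis $X_1,\dots,X_m$ and odd basis $Y_1,\dots,Y_n$, let $\Pi M$ be its parity change, and let $\mathfrak S_d$ act on the right of $M^{\otimes d}$ (and likewise of $(\Pi M)^{\otimes d}$) so that the transposition $(i\ i{+}1)$ exchanges the homogeneous factors $v_i,v_{i+1}$ with the sign $(-1)^{|v_i||v_{i+1}|}$. Write $S^r M=(M^{\otimes r})_{\mathfrak S_r}$ for the coinvariants (the $r$-th super symmetric power) and $\Gamma^r(\Pi M)=((\Pi M)^{\otimes r})^{\mathfrak S_r}$ for the invariants (the $r$-th super divided power). Let $\lambda'$ be the conjugate partition. The Schur supermodule $\widehat S_\lambda(k^{m|n})$ is the image of the composite $$\Gamma^{\lambda'_1}(\Pi M)\otimes\Gamma^{\lambda'_2}(\Pi M)\otimes\cdots\hookrightarrow(\Pi M)^{\otimes d}\cong M^{\otimes d}\xrightarrow{\ \sigma_\lambda\ }M^{\otimes d}\twoheadrightarrow S^{\lambda_1}M\otimes S^{\lambda_2}M\otimes\cdots,$$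 where the isomorphism is $1^{\otimes d}$ for the odd identity map $1:\Pi M\to M$ (with the rule of signs), and $\sigma_\lambda\in\mathfrak S_d$ sends the position of each cell of the diagram of $\lambda$ in the reading along rows to its position in the reading down columns. It is a submodule of $S^{\lambda_1}M\otimes S^{\lambda_2}M\otimes\cdots$ over the Schur superalgebra $S(m|n,d)=\mathrm{End}_{k\mathfrak S_d}(M^{\otimes d})$. For $\mu\in\mathbb Z_{\ge0}^{m+n}$ with $|\mu|=d$ let $E^{(\mu)}\in S(m|n,d)$ be the weight idempotent, that is, the projection of $M^{\otimes d}$ onto the span of the tensors of basis vectors in which the $i$-th basis vector (in the order $X_1,\dots,X_m,Y_1,\dots,Y_n$) occurs exactly $\mu_i$ times for every $i$, along the other such tensors. The formal character of a finite-dimensional $S(m|n,d)$-supermodule $V$ is $$\mathrm{ch}(V)=\sum_{|\mu|=d}\dim_k\bigl(E^{(\mu)}V\bigr)\,x_1^{\mu_1}\cdots x_m^{\mu_m}y_1^{\mu_{m+1}}\cdots y_n^{\mu_{m+n}}\in\mathbb Z[x_1,\dots,x_m;y_1,\dots,y_n].$$ Then $$\mathrm{ch}\bigl(\widehat S_\lambda(k^{m|n})\bigr)=hs_\lambda(x_1,\dots,x_m;y_1,\dots,y_n):=\sum_{\mu\subset\lambda}s_\mu(x_1,\dots,x_m)\,s_{\lambda'/\mu'}(y_1,\dots,y_n),$$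 the hook Schur function, where $\mu$ runs over the partitions contained in $\lambda$ and $s_{\alpha/\beta}$ (with $s_\alpha=s_{\alpha/\varnothing}$) is the skew Schur polynomial, the generating function of the semistandard tableaux of shape $\alpha/\beta$. -/

import Mathlib

open scoped TensorProduct

noncomputable section

namespace SchurSuper

/-! ### Superspaces with a homogeneous basis, and their tensor powers

A superspace with a homogeneous basis indexed by `ι` is the vector space `ι → k` together with a
parity function `p : ι → ZMod 2`.  Its parity change `Π` is the same vector space with parity
function `fun a => p a + 1`. -/

/-- The parity of the standard basis `X₁, …, X_m, Y₁, …, Y_n` of `k^{m|n}`. -/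
def parity (m n : ℕ) : Fin m ⊕ Fin n → ZMod 2 := Sum.elim (fun _ => 0) (fun _ => 1)

/-- The tensor power `M^{⊗ d}` of `M = k^ι`. -/
def TensorPow (k : Type*) [Field k] (ι : Type*) (d : ℕ) : Type _ :=
  ⨂[k] (_ : Fin d), (ι → k)

instance (k : Type*) [Field k] (ι : Type*) (d : ℕ) : AddCommGroup (TensorPow k ι d) :=
  inferInstanceAs (AddCommGroup (⨂[k] (_ : Fin d), (ι → k)))

instance (k : Type*) [Field k] (ι : Type*) (d : ℕ) : Module k (TensorPow k ι d) :=
  inferInstanceAs (Module k (⨂[k] (_ : Fin d), (ι → k)))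

section

variable {k : Type*} [Field k] {ι : Type*} [Fintype ι] {d : ℕ}

variable (k ι d) in
/-- The basis `Z^w = Z_{w 1} ⊗ ⋯ ⊗ Z_{w d}` of `M^{⊗ d}`, indexed by the words `w`. -/
def wordBasis : Module.Basis (Fin d → ι) k (TensorPow k ι d) :=
  Basis.piTensorProduct fun _ => Pi.basisFun k ι

/-- The pairs of positions `s < t` that are interchanged when a word `w` is replaced by `w ∘ σ`. -/
def inversions (σ : Equiv.Perm (Fin d)) : Finset (Fin d × Fin d) :=
  {st | st.1 < st.2 ∧ σ.symm st.2 < σ.symm st.1}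

/-- The sign in `Z^w . σ = ± Z^{w ∘ σ}`: a factor `-1` for each pair of odd letters that are
interchanged. -/
def superSign (p : ι → ZMod 2) (w : Fin d → ι) (σ : Equiv.Perm (Fin d)) : ℤˣ :=
  ∏ st ∈ inversions σ, (-1 : ℤˣ) ^ (p (w st.1) * p (w st.2))

variable (k) in
/-- The right action of a permutation `σ` on `M^{⊗ d}`, for `M = k^ι` with parity `p`:
the linear map `x ↦ x . σ` with `Z^w . σ = ± Z^{w ∘ σ}`. -/
def permAct (p : ι → ZMod 2) (σ : Equiv.Perm (Fin d)) : TensorPow k ι d →ₗ[k] TensorPow k ι d :=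
  (wordBasis k ι d).constr k fun w => superSign p w σ • wordBasis k ι d (w ∘ σ)

variable (k) in
/-- The map `1^{⊗ d} : (Π M)^{⊗ d} → M^{⊗ d}`, where `1 : Π M → M` is the odd identity map.
By the rule of signs, the `t`-th factor `1` moves past the elements `Π Z_{w s}` with `s < t`. -/
def parityShift (p : ι → ZMod 2) : TensorPow k ι d →ₗ[k] TensorPow k ι d :=
  (wordBasis k ι d).constr k fun w =>
    (∏ st : Fin d × Fin d with st.1 < st.2, (-1 : ℤˣ) ^ (p (w st.1) + 1)) • wordBasis k ι d w

/-- The Young subgroup of permutations of the positions that preserve each block; the block of a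
position `r` is labelled by `b r`. -/
def youngSubgroup (b : Fin d → ℕ) : Subgroup (Equiv.Perm (Fin d)) where
  carrier := {σ | ∀ r, b (σ r) = b r}
  mul_mem' := by
    intro σ τ hσ hτ r
    rw [Equiv.Perm.mul_apply, hσ, hτ]
  one_mem' := fun _ => rfl
  inv_mem' := by
    intro σ hσ r
    have h := hσ (σ.symm r)
    rw [Equiv.apply_symm_apply] at h
    exact h.symm

variable (k) in
/-- `Γ^{α₁} M ⊗ ⋯ ⊗ Γ^{α_q} M`, as the subspace of `M^{⊗ d}` of invariants under the Young subgroup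
`𝔖_{α₁} × ⋯ × 𝔖_{α_q}`, where `b` is the division of `{1, …, d}` into successive blocks of lengths
`α₁, …, α_q`. -/
def dividedPow (p : ι → ZMod 2) (b : Fin d → ℕ) : Submodule k (TensorPow k ι d) :=
  ⨅ σ ∈ youngSubgroup b, LinearMap.eqLocus (permAct k p σ) LinearMap.id

theorem permAct_wordBasis (p : ι → ZMod 2) (σ : Equiv.Perm (Fin d)) (w : Fin d → ι) :
    permAct k p σ (wordBasis k ι d w) = superSign p w σ • wordBasis k ι d (w ∘ σ) :=
  Module.Basis.constr_basis ..

theorem prod_pairs_comp (σ : Equiv.Perm (Fin d)) (f : Fin d → Fin d → ℤˣ) :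
    ∏ st : Fin d × Fin d with st.1 < st.2, f (σ st.1) (σ st.2) =
      ∏ st : Fin d × Fin d with st.1 < st.2,
        if σ.symm st.2 < σ.symm st.1 then f st.2 st.1 else f st.1 st.2 := by
  refine Finset.prod_bij'
    (fun st _ => if σ st.2 < σ st.1 then (σ st.2, σ st.1) else (σ st.1, σ st.2))
    (fun st _ => if σ.symm st.2 < σ.symm st.1 then (σ.symm st.2, σ.symm st.1) else (σ.symm st.1, σ.symm st.2))
    ?_ ?_ ?_ ?_ ?_
  · rintro ⟨s, t⟩ h
    have hne : σ s ≠ σ t := σ.injective.ne (by simp at h; exact h.ne)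
    by_cases h' : σ t < σ s
    · simp [h']
    · simpa [h'] using lt_of_le_of_ne (not_lt.1 h') hne
  · rintro ⟨s, t⟩ h
    have hne : σ.symm s ≠ σ.symm t := σ.symm.injective.ne (by simp at h; exact h.ne)
    by_cases h' : σ.symm t < σ.symm s
    · simp [h']
    · simpa [h'] using lt_of_le_of_ne (not_lt.1 h') hne
  · rintro ⟨s, t⟩ h
    replace h : s < t := by simpa using h
    by_cases h' : σ t < σ s
    · simp [h', h]
    · simp [h', h.not_gt]
  · rintro ⟨s, t⟩ h
    replace h : s < t := by simpa using h
    by_cases h' : σ.symm t < σ.symm s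
    · simp [h', h]
    · simp [h', h.not_gt]
  · rintro ⟨s, t⟩ h
    replace h : s < t := by simpa using h
    by_cases h' : σ t < σ s
    · simp [h', h]
    · simp [h', h.not_gt]

theorem prod_inversions (σ : Equiv.Perm (Fin d)) (f : Fin d × Fin d → ℤˣ) :
    ∏ st ∈ inversions σ, f st =
      ∏ st : Fin d × Fin d with st.1 < st.2, if σ.symm st.2 < σ.symm st.1 then f st else 1 := by
  rw [inversions, ← Finset.filter_filter, Finset.prod_filter]

theorem symm_mul' (σ τ : Equiv.Perm (Fin d)) (r : Fin d) : (σ * τ).symm r = τ.symm (σ.symm r) :=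
  rfl

/-- The maps `permAct` form a right action. -/
theorem permAct_mul (p : ι → ZMod 2) (σ τ : Equiv.Perm (Fin d)) (x : TensorPow k ι d) :
    permAct k p (σ * τ) x = permAct k p τ (permAct k p σ x) := by
  suffices h : permAct k p (σ * τ) = permAct k p τ ∘ₗ permAct k p σ from
    LinearMap.congr_fun h x
  refine (wordBasis k ι d).ext fun w => ?_
  rw [LinearMap.comp_apply, permAct_wordBasis, permAct_wordBasis, Units.smul_def, Units.smul_def,
    map_zsmul, permAct_wordBasis, Units.smul_def, smul_smul, ← Units.val_mul]
  have h : superSign p w (σ * τ) = superSign p w σ * superSign p (w ∘ σ) τ := by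
    have h2 := prod_pairs_comp σ fun s t =>
      if τ.symm (σ.symm t) < τ.symm (σ.symm s) then (-1 : ℤˣ) ^ (p (w s) * p (w t)) else 1
    simp only [Equiv.symm_apply_apply] at h2
    simp only [superSign, prod_inversions, Function.comp_apply, h2, ← Finset.prod_mul_distrib,
      symm_mul']
    refine Finset.prod_congr rfl ?_
    rintro ⟨s, t⟩ h
    have hne : τ.symm (σ.symm s) ≠ τ.symm (σ.symm t) := by simp at h; simpa using h.ne
    have hc : p (w t) * p (w s) = p (w s) * p (w t) := mul_comm _ _
    dsimp only
    rcases lt_or_gt_of_ne hne with h3 | h3 <;>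
      by_cases h1 : σ.symm t < σ.symm s <;>
      simp [h1, h3, h3.not_gt, hc, Int.units_mul_self]
  rw [h]
  rfl

theorem parityShift_wordBasis (p : ι → ZMod 2) (w : Fin d → ι) :
    parityShift k p (wordBasis k ι d w) =
      (∏ st : Fin d × Fin d with st.1 < st.2, (-1 : ℤˣ) ^ (p (w st.1) + 1)) •
        wordBasis k ι d w :=
  Module.Basis.constr_basis ..

theorem parityShift_parityShift (p : ι → ZMod 2) (x : TensorPow k ι d) :
    parityShift k p (parityShift k p x) = x := by
  suffices h : parityShift k p ∘ₗ parityShift k p = LinearMap.id (M := TensorPow k ι d) from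
    LinearMap.congr_fun h x
  refine (wordBasis k ι d).ext fun w => ?_
  rw [LinearMap.comp_apply, parityShift_wordBasis, Units.smul_def, map_zsmul,
    parityShift_wordBasis, Units.smul_def, smul_smul, ← Units.val_mul, Int.units_mul_self]
  simp

/-- `1^{⊗ d}` intertwines the actions on `(Π M)^{⊗ d}` and `M^{⊗ d}` up to the sign of the
permutation. -/
theorem parityShift_permAct (p : ι → ZMod 2) (σ : Equiv.Perm (Fin d)) (x : TensorPow k ι d) :
    parityShift k p (permAct k (fun a => p a + 1) σ x) =
      (∏ _st ∈ inversions σ, (-1 : ℤˣ)) • permAct k p σ (parityShift k p x) := by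
  suffices h : parityShift k p ∘ₗ permAct k (fun a => p a + 1) σ =
      ((((∏ _st ∈ inversions σ, (-1 : ℤˣ) : ℤˣ) : ℤ) : k)) •
        (permAct k p σ ∘ₗ parityShift k p) by
    have h' := LinearMap.congr_fun h x
    rwa [LinearMap.smul_apply, Int.cast_smul_eq_zsmul, ← Units.smul_def] at h'
  refine (wordBasis k ι d).ext fun w => ?_
  rw [LinearMap.smul_apply, Int.cast_smul_eq_zsmul, LinearMap.comp_apply, LinearMap.comp_apply,
    permAct_wordBasis, parityShift_wordBasis, Units.smul_def, Units.smul_def, map_zsmul, map_zsmul,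
    permAct_wordBasis, parityShift_wordBasis, Units.smul_def, Units.smul_def, smul_smul,
    smul_smul, smul_smul, ← Units.val_mul, ← Units.val_mul, ← Units.val_mul]
  congr 2
  have h2 := prod_pairs_comp σ fun s _ => (-1 : ℤˣ) ^ (p (w s) + 1)
  simp only [superSign, prod_inversions, Function.comp_apply, h2, ← Finset.prod_mul_distrib]
  refine Finset.prod_congr rfl ?_
  rintro ⟨s, t⟩ -
  dsimp only
  generalize p (w s) = a
  generalize p (w t) = b
  by_cases h1 : σ.symm t < σ.symm s
  · simp only [if_pos h1]
    revert a b
    decide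
  · simp [if_neg h1]

end

/-! ### The Schur superalgebra and its supermodules -/

section

variable (k : Type*) [Field k] (m n d : ℕ)

/-- The Schur superalgebra `S(m|n,d) = Γ^d End(M) ≅ End_{k𝔖_d}(M^{⊗ d})`, for `M = k^{m|n}`. -/
def SchurSuperalgebra : Subalgebra k (Module.End k (TensorPow k (Fin m ⊕ Fin n) d)) :=
  Subalgebra.centralizer k (Set.range (permAct k (parity m n)))

/-- The weight of a word: the number of occurrences of each letter. -/
def wordWeight {ι : Type*} [Fintype ι] [DecidableEq ι] {d : ℕ} (w : Fin d → ι) : ι →₀ ℕ :=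
  ∑ r, Finsupp.single (w r) 1

/-- The elementary tensor `E_{w₁,w₁} ⊗ ⋯ ⊗ E_{w_d,w_d}` of matrix units, as an endomorphism of
`M^{⊗ d}`.  All factors are even, so that no sign occurs. -/
def diagonalUnit {ι : Type*} [Fintype ι] [DecidableEq ι] {d : ℕ} (w : Fin d → ι) :
    Module.End k (TensorPow k ι d) :=
  PiTensorProduct.map fun r => Matrix.toLin' (Matrix.single (w r) (w r) (1 : k))

theorem diagonalUnit_wordBasis {ι : Type*} [Fintype ι] [DecidableEq ι] {d : ℕ}
    (w v : Fin d → ι) :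
    diagonalUnit k w (wordBasis k ι d v) = if w = v then wordBasis k ι d v else 0 := by
  have key : PiTensorProduct.map (fun r => Matrix.toLin' (Matrix.single (w r) (w r) (1 : k)))
      (Basis.piTensorProduct (fun _ => Pi.basisFun k ι) v) =
      if w = v then Basis.piTensorProduct (fun _ => Pi.basisFun k ι) v else 0 := by
    rw [Basis.piTensorProduct_apply, PiTensorProduct.map_tprod]
    split_ifs with h
    · subst h
      congr 1
      ext r a
      simp [Matrix.single_apply, Pi.single_apply, eq_comm]
    · obtain ⟨r, hr⟩ := Function.ne_iff.1 h
      refine (PiTensorProduct.tprod k).map_coord_zero r ?_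
      ext a
      simp [hr]
  exact key

theorem sum_diagonalUnit_wordBasis {ι : Type*} [Fintype ι] [DecidableEq ι] {d : ℕ}
    (μ : ι →₀ ℕ) (v : Fin d → ι) :
    (∑ w : Fin d → ι with wordWeight w = μ, diagonalUnit k w) (wordBasis k ι d v) =
      if wordWeight v = μ then wordBasis k ι d v else 0 := by
  rw [LinearMap.sum_apply]
  simp only [diagonalUnit_wordBasis, Finset.sum_ite_eq', Finset.mem_filter, Finset.mem_univ,
    true_and]

/-- The weight idempotent `E^{(μ)} ∈ S(m|n,d)`: the sum of `E_{w₁,w₁} ⊗ ⋯ ⊗ E_{w_d,w_d}` over the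
`𝔖_d`-orbit of words of weight `μ`. -/
def weightIdempotent (μ : Fin m ⊕ Fin n →₀ ℕ) : SchurSuperalgebra k m n d :=
  ⟨∑ w : Fin d → Fin m ⊕ Fin n with wordWeight w = μ, diagonalUnit k w, by
    rw [SchurSuperalgebra, Subalgebra.mem_centralizer_iff]
    rintro _ ⟨σ, rfl⟩
    refine (wordBasis k _ d).ext fun v => ?_
    have hw : wordWeight (v ∘ σ) = wordWeight v :=
      Equiv.sum_comp σ fun r => Finsupp.single (v r) 1
    rw [Module.End.mul_apply, Module.End.mul_apply, sum_diagonalUnit_wordBasis, permAct_wordBasis,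
      Units.smul_def, map_zsmul, sum_diagonalUnit_wordBasis, hw]
    split_ifs
    · rw [permAct_wordBasis, Units.smul_def]
    · simp⟩

section

variable (V : Type*) [AddCommGroup V] [Module k V] [Module (SchurSuperalgebra k m n d) V]
  [IsScalarTower k (SchurSuperalgebra k m n d) V]

/-- The weight space `V_μ = E^{(μ)} V` of an `S(m|n,d)`-supermodule `V`. -/
def weightSpace (μ : Fin m ⊕ Fin n →₀ ℕ) : Submodule k V :=
  LinearMap.range (Algebra.lsmul k k V (weightIdempotent k m n d μ))

/-- The formal character `∑_μ dim(V_μ) z^μ` of a finite-dimensional `S(m|n,d)`-supermodule `V`, the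
sum being over all `μ ∈ ℕ^{m+n}` with `|μ| = d`.  The variables are `x_i = X (Sum.inl i)` and
`y_j = X (Sum.inr j)`. -/
def formalCharacter [Module.Finite k V] : MvPolynomial (Fin m ⊕ Fin n) ℤ :=
  ∑ μ ∈ Finset.finsuppAntidiag (Finset.univ : Finset (Fin m ⊕ Fin n)) d,
    MvPolynomial.monomial μ (Module.finrank k (weightSpace k m n d V μ) : ℤ)

end

/-- The action of `σ` on `M^{⊗ d}`, as an endomorphism of `S(m|n,d)`-modules. -/
def permActLinear (σ : Equiv.Perm (Fin d)) :
    TensorPow k (Fin m ⊕ Fin n) d →ₗ[SchurSuperalgebra k m n d] TensorPow k (Fin m ⊕ Fin n) d where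
  toFun := permAct k (parity m n) σ
  map_add' := map_add _
  map_smul' f x := by
    have h := (Subalgebra.mem_centralizer_iff k).1 f.2 _ ⟨σ, rfl⟩
    exact LinearMap.congr_fun h x

theorem permAct_smul (σ : Equiv.Perm (Fin d)) (f : SchurSuperalgebra k m n d)
    (x : TensorPow k (Fin m ⊕ Fin n) d) :
    permAct k (parity m n) σ (f • x) = f • permAct k (parity m n) σ x :=
  (permActLinear k m n d σ).map_smul f x

variable {d}

/-- The `S(m|n,d)`-submodule of `M^{⊗ d}` spanned by all `x . σ - x` with `σ` in the Young
subgroup of `b`. -/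
def symRelations (b : Fin d → ℕ) :
    Submodule (SchurSuperalgebra k m n d) (TensorPow k (Fin m ⊕ Fin n) d) :=
  ⨆ σ ∈ youngSubgroup b, LinearMap.range (permActLinear k m n d σ - LinearMap.id)

/-- `S^{α₁} M ⊗ ⋯ ⊗ S^{α_q} M`, as the quotient of `M^{⊗ d}` of coinvariants under the Young
subgroup `𝔖_{α₁} × ⋯ × 𝔖_{α_q}`, with `b` the division into blocks of lengths `α₁, …, α_q`. -/
def SymPow (b : Fin d → ℕ) : Type _ :=
  TensorPow k (Fin m ⊕ Fin n) d ⧸ symRelations k m n b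

instance (b : Fin d → ℕ) : AddCommGroup (SymPow k m n b) :=
  inferInstanceAs (AddCommGroup (_ ⧸ symRelations k m n b))

instance (b : Fin d → ℕ) : Module (SchurSuperalgebra k m n d) (SymPow k m n b) :=
  inferInstanceAs (Module (SchurSuperalgebra k m n d) (_ ⧸ symRelations k m n b))

instance (b : Fin d → ℕ) : Module k (SymPow k m n b) :=
  inferInstanceAs (Module k (_ ⧸ symRelations k m n b))

instance (b : Fin d → ℕ) : IsScalarTower k (SchurSuperalgebra k m n d) (SymPow k m n b) :=
  inferInstanceAs (IsScalarTower k (SchurSuperalgebra k m n d) (_ ⧸ symRelations k m n b))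

/-- The multiplication map `m : M^{⊗ d} → S^{α₁} M ⊗ ⋯ ⊗ S^{α_q} M`. -/
def symMk (b : Fin d → ℕ) :
    TensorPow k (Fin m ⊕ Fin n) d →ₗ[SchurSuperalgebra k m n d] SymPow k m n b :=
  (symRelations k m n b).mkQ

end

/-! ### Partitions and Schur supermodules -/

/-- The enumeration of the cells of a Young diagram in the order in which `e` is
lexicographically increasing. -/
def readingOrder (lam : YoungDiagram) (e : ℕ × ℕ ≃ ℕ ×ₗ ℕ) : Fin lam.card ≃ lam.cells :=
  ((lam.cells.map e.toEmbedding).orderIsoOfFin (Finset.card_map _)).toEquiv.trans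
    (e.subtypeEquiv fun _ => (Finset.mem_map' e.toEmbedding).symm).symm

/-- Reading along rows, from top to bottom. -/
def rowReading (lam : YoungDiagram) : Fin lam.card ≃ lam.cells :=
  readingOrder lam toLex

/-- Reading down columns, from left to right. -/
def colReading (lam : YoungDiagram) : Fin lam.card ≃ lam.cells :=
  readingOrder lam ((Equiv.prodComm ℕ ℕ).trans toLex)

/-- The division of `{1, …, d}` into blocks of lengths `λ₁, λ₂, …`. -/
def rowBlock (lam : YoungDiagram) (r : Fin lam.card) : ℕ := (rowReading lam r).1.1

/-- The division of `{1, …, d}` into blocks of lengths `λ'₁, λ'₂, …`, the column lengths of `λ`. -/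
def colBlock (lam : YoungDiagram) (r : Fin lam.card) : ℕ := (colReading lam r).1.2

/-- The permutation `σ_λ` that sends the position of a cell in the row reading to its position in
the column reading. -/
def sigma (lam : YoungDiagram) : Equiv.Perm (Fin lam.card) :=
  (rowReading lam).trans (colReading lam).symm

section

variable (k : Type*) [Field k] (m n : ℕ) (lam : YoungDiagram)

/-- The map `θ̂_λ` from `Γ_Π^{λ'} M = Γ^{λ'₁}(Π M) ⊗ Γ^{λ'₂}(Π M) ⊗ ⋯` to
`S^λ M = S^{λ₁} M ⊗ S^{λ₂} M ⊗ ⋯`: the inclusion into `(Π M)^{⊗ d}`, the odd identification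
`1^{⊗ d}` of `(Π M)^{⊗ d}` with `M^{⊗ d}`, the action of `σ_λ`, and multiplication. -/
def theta :
    dividedPow k (fun a => parity m n a + 1) (colBlock lam) →ₗ[k] SymPow k m n (rowBlock lam) :=
  (symMk k m n (rowBlock lam)).restrictScalars k ∘ₗ permAct k (parity m n) (sigma lam) ∘ₗ
    parityShift k (parity m n) ∘ₗ
      (dividedPow k (fun a => parity m n a + 1) (colBlock lam)).subtype

theorem theta_apply (x : dividedPow k (fun a => parity m n a + 1) (colBlock lam)) :
    theta k m n lam x = symMk k m n (rowBlock lam)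
      (permActLinear k m n lam.card (sigma lam) (parityShift k (parity m n) x.1)) :=
  rfl

/-- The Schur supermodule `Ŝ_λ(k^{m|n})`: the image of `θ̂_λ`, an `S(m|n,d)`-submodule of `S^λ M`,
where `d = |λ|`. -/
def SchurSupermodule :
    Submodule (SchurSuperalgebra k m n lam.card) (SymPow k m n (rowBlock lam)) where
  carrier := Set.range (theta k m n lam)
  add_mem' := by
    rintro _ _ ⟨x, rfl⟩ ⟨y, rfl⟩
    exact ⟨x + y, map_add _ _ _⟩
  zero_mem' := ⟨0, map_zero _⟩
  smul_mem' := by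
    rintro f _ ⟨⟨x, hx⟩, rfl⟩
    refine ⟨⟨parityShift k (parity m n) (f • parityShift k (parity m n) x), ?_⟩, ?_⟩
    · simp only [dividedPow, Submodule.mem_iInf, LinearMap.mem_eqLocus, LinearMap.id_apply]
        at hx ⊢
      intro σ hσ
      apply (Function.LeftInverse.injective (parityShift_parityShift (k := k) (parity m n)))
      rw [parityShift_permAct, parityShift_parityShift]
      rw [permAct_smul, Units.smul_def, ← smul_comm, ← Units.smul_def, ← parityShift_permAct,
        hx σ hσ]
    · rw [theta_apply, theta_apply, parityShift_parityShift, map_smul, map_smul]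

instance : Module.Finite k (TensorPow k (Fin m ⊕ Fin n) lam.card) :=
  Module.Finite.of_basis (wordBasis k (Fin m ⊕ Fin n) lam.card)

instance : Module.Finite k (SymPow k m n (rowBlock lam)) :=
  Module.Finite.of_surjective ((symMk k m n (rowBlock lam)).restrictScalars k)
    (Submodule.mkQ_surjective (symRelations k m n (rowBlock lam)))

instance : Module.Finite k (SchurSupermodule k m n lam) :=
  Module.Finite.of_injective
    ((SchurSupermodule k m n lam).subtype.restrictScalars k) Subtype.val_injective

end

/-! ### Hook Schur functions -/

/-- The semistandard tableaux of skew shape `lam / mu` with entries in `{1, …, n}`: the entries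
weakly increase along the rows and strictly increase down the columns. -/
def skewTableaux (n : ℕ) (lam mu : YoungDiagram) :
    Set ((lam.cells \ mu.cells : Finset (ℕ × ℕ)) → Fin n) :=
  {T | (∀ c c', c.1.1 = c'.1.1 → c.1.2 < c'.1.2 → T c ≤ T c') ∧
    (∀ c c', c.1.2 = c'.1.2 → c.1.1 < c'.1.1 → T c < T c')}

open Classical in
/-- The skew Schur polynomial `s_{lam/mu}(x₁, …, x_n)`, for `mu ≤ lam`. -/
def skewSchur (n : ℕ) (lam mu : YoungDiagram) : MvPolynomial (Fin n) ℤ :=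
  ∑ T ∈ (skewTableaux n lam mu).toFinset, ∏ c, MvPolynomial.X (T c)

/-- The Schur polynomial `s_mu(x₁, …, x_n)`. -/
def schur (n : ℕ) (mu : YoungDiagram) : MvPolynomial (Fin n) ℤ := skewSchur n mu ⊥

theorem finite_subdiagrams (lam : YoungDiagram) : {mu : YoungDiagram | mu ≤ lam}.Finite := by
  refine Set.Finite.of_finite_image (f := YoungDiagram.cells)
    ((lam.cells.powerset.finite_toSet).subset ?_) ?_
  · rintro _ ⟨mu, hmu, rfl⟩
    exact Finset.mem_coe.2 (Finset.mem_powerset.2 hmu)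
  · intro mu _ nu _ h
    exact YoungDiagram.ext h

/-- The hook Schur function
`hs_λ(x₁, …, x_m; y₁, …, y_n) = ∑_{μ ⊆ λ} s_μ(x₁, …, x_m) s_{λ'/μ'}(y₁, …, y_n)`. -/
def hookSchur (m n : ℕ) (lam : YoungDiagram) : MvPolynomial (Fin m ⊕ Fin n) ℤ :=
  ∑ mu ∈ (finite_subdiagrams lam).toFinset,
    MvPolynomial.rename Sum.inl (schur m mu) *
      MvPolynomial.rename Sum.inr (skewSchur n lam.transpose mu.transpose)

end SchurSuper

end

/-! The Schur supermodule has a basis of weight vectors indexed by the semistandard fillings of λ by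
the letters X₁ < ⋯ < X_m < Y₁ < ⋯ < Y_n: ranks weakly increase along rows and down columns, even
letters do not repeat in a column, and odd letters do not repeat in a row. The even letters of such
a filling occupy a subdiagram μ and form a semistandard tableau there; the odd letters form, after
transposition, a semistandard tableau of shape λ'/μ'. The generating function of these fillings is
therefore the hook Schur function (`hookSchur_eq_sum`).

To find the basis, transport by 1^{⊗d} and σ_λ: the supermodule is the image, in the coinvariants of
the row group, of the tensors on which the column group acts by the sign character
(`mem_schurSupermodule_iff`). Since 2 ≠ 0 in k, these tensors are spanned by signed column orbit
sums of words on whose stabilizer the twisted sign is trivial. Dually, the functionals on the row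
coinvariants are spanned by signed row orbit functions (`Equivariant.mem_span`). All linear
relations are thus governed by the integers `orbitPairing`, which do not depend on k.

Independence: on semistandard words the pairing matrix is unitriangular for the statistic ∑ row ·
rank, by the rearrangement inequality, so it has determinant 1 and stays invertible over every field
(`det_orbitPairing`).

Spanning: over ℚ, super Garnir relations rewrite every column sum through semistandard ones
(`columnSum_mem_span`). The relations require division by integers that may vanish in k. But the
pairing matrix has determinant 1, so by Cramer's rule the rational coefficients on orbit sums are
integers (`exists_orbitPairing_eq`), and the straightening law can be reduced to k. -/

namespace SchurSuper

/-! ### Sign cocycles of the place permutation action -/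

section signs

variable {ι : Type*} {d : ℕ}

/-- A pair of letters is interchanged by the product exactly when it is interchanged by one of the
two successive moves; a pair interchanged twice contributes its sign squared. This is the cocycle
identity behind `permAct_mul`. -/
theorem superSign_mul (p : ι → ZMod 2) (w : Fin d → ι) (σ τ : Equiv.Perm (Fin d)) :
    superSign p w (σ * τ) = superSign p w σ * superSign p (w ∘ σ) τ := by
  have h2 := prod_pairs_comp σ fun s t =>
    if τ.symm (σ.symm t) < τ.symm (σ.symm s) then (-1 : ℤˣ) ^ (p (w s) * p (w t)) else 1
  simp only [Equiv.symm_apply_apply] at h2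
  simp only [superSign, prod_inversions, Function.comp_apply, h2, ← Finset.prod_mul_distrib,
    symm_mul']
  refine Finset.prod_congr rfl ?_
  rintro ⟨s, t⟩ h
  have hne : τ.symm (σ.symm s) ≠ τ.symm (σ.symm t) := by simp at h; simpa using h.ne
  have hc : p (w t) * p (w s) = p (w s) * p (w t) := mul_comm _ _
  dsimp only
  rcases lt_or_gt_of_ne hne with h3 | h3 <;>
    by_cases h1 : σ.symm t < σ.symm s <;>
    simp [h1, h3, h3.not_gt, hc, Int.units_mul_self]

theorem prod_inversions_neg_one (σ : Equiv.Perm (Fin d)) :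
    ∏ _st ∈ inversions σ, (-1 : ℤˣ) = Equiv.Perm.sign σ := by
  rw [← Equiv.Perm.sign_symm, Equiv.Perm.sign_eq_prod_prod_Iio, prod_inversions,
    Finset.prod_filter, ← Finset.univ_product_univ, Finset.prod_product_right]
  refine Finset.prod_congr rfl fun t _ => ?_
  rw [← Finset.prod_filter]
  refine Finset.prod_congr (by ext; simp) fun s hs => ?_
  have hne : σ.symm s ≠ σ.symm t := σ.symm.injective.ne (by simp at hs; exact hs.ne)
  rcases lt_or_gt_of_ne hne with h | h <;> simp [h, h.not_gt]

/-- A permutation fixing a word and all its odd positions acts without a sign. -/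
theorem superSign_eq_one (p : ι → ZMod 2) (w : Fin d → ι) (σ : Equiv.Perm (Fin d))
    (h : ∀ r, p (w r) ≠ 0 → σ r = r) : superSign p w σ = 1 := by
  refine Finset.prod_eq_one fun st hst => ?_
  obtain ⟨h1, h2⟩ : st.1 < st.2 ∧ σ.symm st.2 < σ.symm st.1 := by simpa [inversions] using hst
  by_cases hs : p (w st.1) = 0
  · simp [hs]
  by_cases ht : p (w st.2) = 0
  · simp [ht]
  rw [(Equiv.symm_apply_eq σ).2 (h _ hs).symm, (Equiv.symm_apply_eq σ).2 (h _ ht).symm] at h2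
  exact absurd h1 h2.not_gt

/-- The sign of the action of `σ` on a word, twisted by the sign character. -/
def twistedSign (p : ι → ZMod 2) (w : Fin d → ι) (σ : Equiv.Perm (Fin d)) : ℤˣ :=
  Equiv.Perm.sign σ * superSign p w σ

theorem twistedSign_mul (p : ι → ZMod 2) (w : Fin d → ι) (σ τ : Equiv.Perm (Fin d)) :
    twistedSign p w (σ * τ) = twistedSign p w σ * twistedSign p (w ∘ σ) τ := by
  simp only [twistedSign, superSign_mul, Equiv.Perm.sign_mul]
  exact mul_mul_mul_comm ..

/-- For general σ the two sides differ by the quotient of the `parityShift` signs of `w` and `w ∘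
σ`, which is trivial on the stabilizer of `w`. Statements about odd letters thereby become
statements about even letters for the twisted sign. -/
theorem superSign_add_one (p : ι → ZMod 2) (w : Fin d → ι) (σ : Equiv.Perm (Fin d))
    (hw : w ∘ σ = w) : superSign (fun a => p a + 1) w σ = twistedSign p w σ := by
  have h2 := prod_pairs_comp σ fun s _ => (-1 : ℤˣ) ^ (p (w s) + 1)
  have h3 : ∀ r, w (σ r) = w r := congr_fun hw
  simp only [h3] at h2
  rw [twistedSign, ← prod_inversions_neg_one]
  rw [← mul_right_inj (∏ st : Fin d × Fin d with st.1 < st.2, (-1 : ℤˣ) ^ (p (w st.1) + 1))]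
  conv_lhs => rw [h2]
  simp only [superSign, prod_inversions, ← Finset.prod_mul_distrib]
  refine Finset.prod_congr rfl ?_
  rintro ⟨s, t⟩ -
  dsimp only
  generalize p (w s) = a
  generalize p (w t) = b
  by_cases h1 : σ.symm t < σ.symm s
  · simp only [if_pos h1]
    revert a b
    decide
  · simp [if_neg h1]

/-- A permutation fixing a word and all its even positions acts by its sign. -/
theorem twistedSign_eq_one (p : ι → ZMod 2) (w : Fin d → ι) (σ : Equiv.Perm (Fin d))
    (hw : w ∘ σ = w) (h : ∀ r, p (w r) = 0 → σ r = r) : twistedSign p w σ = 1 := by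
  rw [← superSign_add_one p w σ hw]
  refine superSign_eq_one _ _ _ fun r hr => h r ?_
  generalize p (w r) = a at hr
  revert a
  decide

end signs

/-! ### Functions equivariant for a sign cocycle, and signed orbit sums -/

section equivariant

variable {ι : Type*} {d : ℕ} (χ : (Fin d → ι) → Equiv.Perm (Fin d) → ℤˣ)
  (H : Subgroup (Equiv.Perm (Fin d)))

/-- The words on whose stabilizer in `H` the cocycle `χ` is trivial. -/
def Admissible (u : Fin d → ι) : Prop := ∀ σ ∈ H, u ∘ σ = u → χ u σ = 1

open Classical in
/-- The coefficient of `v` in the signed sum over the `H`-orbit of `u`. -/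
noncomputable def orbitCoeff (u v : Fin d → ι) : ℤ :=
  if h : ∃ σ ∈ H, u ∘ σ = v then (χ u h.choose : ℤ) else 0

/-- The functions on words that `H` multiplies by `χ`. -/
def Equivariant {k : Type*} [Ring k] (g : (Fin d → ι) → k) : Prop :=
  ∀ w, ∀ σ ∈ H, g (w ∘ σ) = ((χ w σ : ℤ) : k) * g w

variable {χ H}

theorem comp_comp_inv (v : Fin d → ι) (σ : Equiv.Perm (Fin d)) :
    (v ∘ σ) ∘ (σ⁻¹ : Equiv.Perm (Fin d)) = v :=
  funext fun r => congr_arg v (σ.apply_symm_apply r)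

/-- The permutation chosen in `orbitCoeff` and `σ` differ by an element of the stabilizer of `u`,
where the cocycle is trivial, so the choice does not affect the sign. -/
theorem orbitCoeff_comp_self (hχ : ∀ w σ τ, χ w (σ * τ) = χ w σ * χ (w ∘ σ) τ)
    {u : Fin d → ι} (hu : Admissible χ H u) {σ : Equiv.Perm (Fin d)} (hσ : σ ∈ H) : orbitCoeff χ H u (u ∘ σ) = χ u σ := by
  have h : ∃ τ ∈ H, u ∘ τ = u ∘ σ := ⟨σ, hσ, rfl⟩
  rw [orbitCoeff, dif_pos h]
  obtain ⟨h1, h2⟩ := h.choose_spec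
  set τ := h.choose
  have h3 : u ∘ (τ * σ⁻¹ : Equiv.Perm (Fin d)) = u := by
    rw [Equiv.Perm.coe_mul, ← Function.comp_assoc, h2, comp_comp_inv]
  have h4 := hχ u (τ * σ⁻¹) σ
  rw [inv_mul_cancel_right, h3, hu _ (H.mul_mem h1 (H.inv_mem hσ)) h3, one_mul] at h4
  rw [h4]

theorem exists_of_orbitCoeff_ne_zero {u v : Fin d → ι} (h : orbitCoeff χ H u v ≠ 0) :
    ∃ σ ∈ H, u ∘ σ = v := by
  by_contra h'
  exact h (dif_neg h')

theorem equivariant_orbitCoeff {k : Type*} [Ring k]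
    (hχ : ∀ w σ τ, χ w (σ * τ) = χ w σ * χ (w ∘ σ) τ) {u : Fin d → ι} (hu : Admissible χ H u) :
    Equivariant χ H fun v => (orbitCoeff χ H u v : k) := by
  intro w σ hσ
  by_cases hw : ∃ τ ∈ H, u ∘ τ = w
  · obtain ⟨τ, hτ, rfl⟩ := hw
    beta_reduce
    rw [Function.comp_assoc, ← Equiv.Perm.coe_mul, orbitCoeff_comp_self hχ hu (H.mul_mem hτ hσ),
      orbitCoeff_comp_self hχ hu hτ, hχ]
    push_cast
    exact ((Int.cast_commute _ _).eq)
  · have h1 : orbitCoeff χ H u w = 0 := dif_neg hw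
    have h2 : orbitCoeff χ H u (w ∘ σ) = 0 := by
      by_contra h
      obtain ⟨τ, hτ, h3⟩ := exists_of_orbitCoeff_ne_zero h
      refine hw ⟨τ * σ⁻¹, H.mul_mem hτ (H.inv_mem hσ), ?_⟩
      rw [Equiv.Perm.coe_mul, ← Function.comp_assoc, h3, comp_comp_inv]
    simp [h1, h2]

/-- If some stabilizing permutation had sign -1, then g u = -g u. This is the point where
characteristic 2 has to be excluded. -/
theorem Equivariant.admissible {k : Type*} [Field k] (hk : (2 : k) ≠ 0) {g : (Fin d → ι) → k}
    (hg : Equivariant χ H g) {u : Fin d → ι} (hu : g u ≠ 0) : Admissible χ H u := by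
  intro σ hσ h
  have h1 := hg u σ hσ
  rcases Int.units_eq_one_or (χ u σ) with h2 | h2
  · exact h2
  · rw [h, h2] at h1
    refine absurd ?_ (mul_ne_zero hk hu)
    push_cast at h1
    linear_combination h1

/-- The equivariant functions are spanned by the signed orbit sums of admissible words. -/
theorem Equivariant.mem_span [Finite ι] {k : Type*} [Field k] (hk : (2 : k) ≠ 0)
    (hχ : ∀ w σ τ, χ w (σ * τ) = χ w σ * χ (w ∘ σ) τ) {g : (Fin d → ι) → k}
    (hg : Equivariant χ H g) :
    g ∈ Submodule.span k
      {f | ∃ u, Admissible χ H u ∧ f = fun v => (orbitCoeff χ H u v : k)} := by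
  induction hN : (Function.support g).ncard using Nat.strong_induction_on generalizing g with
  | _ N ih =>
  by_cases h0 : g = 0
  · rw [h0]
    exact Submodule.zero_mem _
  obtain ⟨u, hu⟩ := Function.ne_iff.1 h0
  have hadm := hg.admissible hk hu
  -- Subtracting `g u` times the orbit function of `u` keeps the support inside that of `g` and
  -- removes `u`, so the induction on the size of the support applies.
  set c : (Fin d → ι) → k := fun v => (orbitCoeff χ H u v : k) with hc
  have hcu : c u = 1 := by
    have h1 := hχ u 1 1
    have h2 := orbitCoeff_comp_self hχ hadm H.one_mem
    simp only [mul_one, Equiv.Perm.coe_one, Function.comp_id] at h1 h2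
    have h3 : χ u 1 = 1 := by simpa using h1
    simp [hc, h2, h3]
  have hceq : Equivariant χ H c := equivariant_orbitCoeff hχ hadm
  have hg' : Equivariant χ H (g - g u • c) := by
    intro w σ hσ
    simp only [Pi.sub_apply, Pi.smul_apply, smul_eq_mul, hg w σ hσ, hceq w σ hσ]
    ring
  have hlt : (Function.support (g - g u • c)).ncard < N := by
    rw [← hN]
    refine Set.ncard_lt_ncard ⟨fun v hv hgv => hv ?_, fun h => h hu ?_⟩ (Set.toFinite _)
    · have hcv : c v = 0 := by
        by_contra hcv
        have h1 : orbitCoeff χ H u v ≠ 0 := fun h => hcv (by simp [hc, h])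
        obtain ⟨σ, hσ, rfl⟩ := exists_of_orbitCoeff_ne_zero h1
        rw [hg u σ hσ] at hgv
        rcases Int.units_eq_one_or (χ u σ) with h2 | h2 <;> simp [h2] at hgv <;> exact hu hgv
      simp [hgv, hcv]
    · simp [hcu]
  have h3 := Submodule.add_mem _ (ih _ hlt hg' rfl)
    (Submodule.smul_mem _ (g u) (Submodule.subset_span ⟨u, hadm, hc⟩))
  rwa [sub_add_cancel] at h3

end equivariant

/-! ### A blockwise rearrangement inequality -/

section rearrangement

variable {d : ℕ}

/-- The rearrangement inequality for permutations preserving the blocks of `b`, and functions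
that increase with `o` on each block. -/
theorem sum_mul_comp_le {b o f : Fin d → ℕ} (hinj : ∀ r s, b r = b s → o r = o s → r = s)
    (hf : ∀ r s, b r = b s → o r < o s → f r ≤ f s) {τ : Equiv.Perm (Fin d)}
    (hτ : τ ∈ youngSubgroup b) :
    ∑ r, o r * f (τ r) ≤ ∑ r, o r * f r ∧
      (∑ r, o r * f (τ r) = ∑ r, o r * f r → ∀ r, f (τ r) = f r) := by
  obtain ⟨K, hK⟩ : ∃ K, ∀ r, f r < K :=
    ⟨1 + ∑ r, f r, fun r => by
      have := Finset.single_le_sum (f := f) (fun _ _ => Nat.zero_le _) (Finset.mem_univ r); omega⟩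
  obtain ⟨L, hL⟩ : ∃ L, ∀ r, o r < L :=
    ⟨1 + ∑ r, o r, fun r => by
      have := Finset.single_le_sum (f := o) (fun _ _ => Nat.zero_le _) (Finset.mem_univ r); omega⟩
  -- Since K and L exceed all values of f and o, adding these multiples of the block label makes F
  -- and G compare first by block. Blockwise monotonicity becomes global, and the usual
  -- rearrangement inequality applies.
  set F : Fin d → ℕ := fun r => f r + K * b r with hF
  set G : Fin d → ℕ := fun r => o r + L * b r with hG
  have hb : ∀ r, b (τ r) = b r := hτ
  have hGlt : ∀ r s, b r < b s → G r < G s := by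
    intro r s h
    have h1 : L * (b r + 1) ≤ L * b s := Nat.mul_le_mul_left _ h
    have := hL r
    simp only [hG]
    nlinarith
  have hGinj : Function.Injective G := by
    intro r s h
    rcases lt_trichotomy (b r) (b s) with h1 | h1 | h1
    · exact absurd h (hGlt _ _ h1).ne
    · refine hinj r s h1 ?_
      simpa [hG, h1] using h
    · exact absurd h (hGlt _ _ h1).ne'
  have hmono : Monovary F G := by
    intro r s h
    rcases lt_trichotomy (b r) (b s) with h1 | h1 | h1
    · have h2 : K * (b r + 1) ≤ K * b s := Nat.mul_le_mul_left _ h1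
      have := hK r
      simp only [hF]
      nlinarith
    · have := hf r s h1 (by simpa [hG, h1] using h)
      simp only [hF, h1]
      omega
    · exact absurd h (hGlt _ _ h1).not_gt
  -- For permutations preserving the blocks, the added terms contribute the same constant.
  have hsum : ∀ π ∈ youngSubgroup b, ∑ r, F (π r) * G r =
      ∑ r, o r * f (π r) + (L * ∑ r, f r * b r + K * ∑ r, b r * G r) := by
    intro π hπ
    have hb : ∀ r, b (π r) = b r := hπ
    rw [← Equiv.sum_comp π fun r => f r * b r, Finset.mul_sum, Finset.mul_sum,
      ← Finset.sum_add_distrib, ← Finset.sum_add_distrib]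
    refine Finset.sum_congr rfl fun r _ => ?_
    simp only [hF, hG, hb]
    ring
  have h1 := hsum τ hτ
  have h2 := hsum 1 (Subgroup.one_mem _)
  simp only [Equiv.Perm.one_apply] at h2
  refine ⟨?_, fun heq r => ?_⟩
  · have := hmono.sum_comp_perm_mul_le_sum_mul (σ := τ)
    omega
  · have h3 := (hmono.sum_comp_perm_mul_eq_sum_mul_iff (σ := τ)).1 (by omega)
    -- In the equality case `F ∘ τ` also monovaries with the injective G. Sorted by G, both F and `F
    -- ∘ τ` are monotone arrangements of the same values, hence equal.
    have key : ∀ {E : Fin d → ℕ}, Monovary E G → Monotone (E ∘ Tuple.sort G) := by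
      intro E hE x y hxy
      rcases (Tuple.monotone_sort G hxy).lt_or_eq with h | h
      · exact hE h
      · exact (congr_arg E (hGinj h)).le
    have h4 : F ∘ (τ * Tuple.sort G : Equiv.Perm (Fin d)) = F ∘ Tuple.sort G :=
      Tuple.unique_monotone (key h3) (key hmono)
    have h5 := congr_fun h4 ((Tuple.sort G).symm r)
    simpa [hF, hb] using h5

end rearrangement

/-! ### Semistandard words and unitriangularity of the orbit pairing -/

section semistandard

variable {ι : Type*} {d : ℕ} (p : ι → ZMod 2) (rk : ι → ℕ) (row col : Fin d → ℕ)

/-- The semistandard fillings: they weakly increase along rows and down columns, equal letters in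
a row are even, and equal letters in a column are odd. -/
def Semistandard (w : Fin d → ι) : Prop :=
  (∀ r s, row r = row s → col r < col s → rk (w r) < rk (w s) ∨ w r = w s ∧ p (w r) = 0) ∧
    ∀ r s, col r = col s → row r < row s → rk (w r) < rk (w s) ∨ w r = w s ∧ p (w r) ≠ 0

variable {p rk row col} {w : Fin d → ι}

theorem Semistandard.row_le (hw : Semistandard p rk row col w) (r s : Fin d) (h : row r = row s)
    (h' : col r < col s) : rk (w r) ≤ rk (w s) := by
  rcases hw.1 r s h h' with h1 | h1
  · exact h1.le
  · rw [h1.1]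

theorem Semistandard.col_le (hw : Semistandard p rk row col w) (r s : Fin d) (h : col r = col s)
    (h' : row r < row s) : rk (w r) ≤ rk (w s) := by
  rcases hw.2 r s h h' with h1 | h1
  · exact h1.le
  · rw [h1.1]

/-- Odd letters do not repeat within a row, so a row permutation stabilizing `w` fixes all odd
positions, and moving even letters costs no sign. The column version below exchanges the two
parities. -/
theorem Semistandard.admissible_row (hinj : ∀ r s, row r = row s → col r = col s → r = s)
    (hw : Semistandard p rk row col w) : Admissible (superSign p) (youngSubgroup row) w := by
  intro σ hσ h
  refine superSign_eq_one p w σ fun r hr => ?_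
  have h1 : w (σ r) = w r := congr_fun h r
  rcases lt_trichotomy (col (σ r)) (col r) with h2 | h2 | h2
  · rcases hw.1 _ _ (hσ r) h2 with h3 | h3
    · rw [h1] at h3; exact absurd h3 (lt_irrefl _)
    · rw [h1] at h3; exact absurd h3.2 hr
  · exact hinj _ _ (hσ r) h2
  · rcases hw.1 _ _ (hσ r).symm h2 with h3 | h3
    · rw [h1] at h3; exact absurd h3 (lt_irrefl _)
    · exact absurd h3.2 hr

theorem Semistandard.admissible_col (hinj : ∀ r s, row r = row s → col r = col s → r = s)
    (hw : Semistandard p rk row col w) : Admissible (twistedSign p) (youngSubgroup col) w := by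
  intro σ hσ h
  refine twistedSign_eq_one p w σ h fun r hr => ?_
  have h1 : w (σ r) = w r := congr_fun h r
  rcases lt_trichotomy (row (σ r)) (row r) with h2 | h2 | h2
  · rcases hw.2 _ _ (hσ r) h2 with h3 | h3
    · rw [h1] at h3; exact absurd h3 (lt_irrefl _)
    · rw [h1] at h3; exact absurd hr h3.2
  · exact hinj _ _ h2 (hσ r)
  · rcases hw.2 _ _ (hσ r).symm h2 with h3 | h3
    · rw [h1] at h3; exact absurd h3 (lt_irrefl _)
    · exact absurd hr h3.2

variable (p row col) in
/-- The pairing between signed sums over row orbits and twisted signed sums over column orbits. -/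
noncomputable def orbitPairing [Fintype ι] (u w : Fin d → ι) : ℤ :=
  ∑ v, orbitCoeff (superSign p) (youngSubgroup row) u v *
    orbitCoeff (twistedSign p) (youngSubgroup col) w v

variable {u : Fin d → ι}

theorem sum_comp_eq_of_mem {f : Fin d → ℕ} {σ : Equiv.Perm (Fin d)} (hσ : σ ∈ youngSubgroup row) :
    ∑ r, row r * f (σ r) = ∑ r, row r * f r := by
  rw [← Equiv.sum_comp σ fun r => row r * f r]
  exact Finset.sum_congr rfl fun r _ => by rw [hσ r]

/-- The statistic ∑ row · rank is constant on row orbits, while a word sorted down its columns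
maximizes it on its column orbit. A common word of the row orbit of `u` and the column orbit of `w`
therefore gives the inequality, and equality forces that word to be `w`. -/
theorem Semistandard.eq_of_orbits (hrk : Function.Injective rk)
    (hinj : ∀ r s, row r = row s → col r = col s → r = s)
    (hu : Semistandard p rk row col u) (hw : Semistandard p rk row col w)
    {ρ τ : Equiv.Perm (Fin d)} (hρ : ρ ∈ youngSubgroup row) (hτ : τ ∈ youngSubgroup col)
    (h : u ∘ ρ = w ∘ τ) :
    ∑ r, row r * rk (u r) ≤ ∑ r, row r * rk (w r) ∧
      (∑ r, row r * rk (u r) = ∑ r, row r * rk (w r) → u = w ∧ w ∘ τ = w) := by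
  have h1 : ∀ r, u (ρ r) = w (τ r) := congr_fun h
  have h2 := sum_comp_eq_of_mem (f := fun r => rk (u r)) hρ
  obtain ⟨h3, h4⟩ := sum_mul_comp_le (b := col) (o := row) (f := fun r => rk (w r))
    (fun r s h h' => hinj r s h' h) hw.col_le hτ
  simp only [h1] at h2
  refine ⟨by omega, fun heq => ?_⟩
  have h5 : ∀ r, w (τ r) = w r := fun r => hrk (h4 (by omega) r)
  have h6 : ∀ r, u (ρ r) = w r := fun r => (h1 r).trans (h5 r)
  refine ⟨?_, funext h5⟩
  -- Now `u` and `w` lie in one row orbit, and both are sorted along rows. Each maximizes ∑ col ·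
  -- rank there, so the sums agree and the equality case gives u = w.
  obtain ⟨h7, h8⟩ := sum_mul_comp_le (b := row) (o := col) (f := fun r => rk (u r))
    hinj hu.row_le hρ
  obtain ⟨h9, -⟩ := sum_mul_comp_le (b := row) (o := col) (f := fun r => rk (w r))
    hinj hw.row_le (Subgroup.inv_mem _ hρ)
  have h10 : ∀ r, u (ρ (ρ⁻¹ r)) = u r := fun r => congr_arg u (ρ.apply_symm_apply r)
  simp only [← h6, h10] at h9
  funext r
  rw [← h6, hrk (h8 (by omega) r)]

theorem orbitCoeff_self {χ : (Fin d → ι) → Equiv.Perm (Fin d) → ℤˣ}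
    {H : Subgroup (Equiv.Perm (Fin d))}
    (hχ : ∀ w σ τ, χ w (σ * τ) = χ w σ * χ (w ∘ σ) τ) (hu : Admissible χ H u) :
    orbitCoeff χ H u u = 1 := by
  have h2 := orbitCoeff_comp_self hχ hu H.one_mem
  rw [hu 1 H.one_mem rfl] at h2
  simpa using h2

theorem Semistandard.orbitPairing_self [Fintype ι] (hrk : Function.Injective rk)
    (hinj : ∀ r s, row r = row s → col r = col s → r = s)
    (hw : Semistandard p rk row col w) : orbitPairing p row col w w = 1 := by
  rw [orbitPairing, Finset.sum_eq_single w,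
    orbitCoeff_self (superSign_mul p) (hw.admissible_row hinj),
    orbitCoeff_self (twistedSign_mul p) (hw.admissible_col hinj), one_mul]
  · intro v _ hv
    by_contra h
    obtain ⟨ρ, hρ, h1⟩ := exists_of_orbitCoeff_ne_zero (left_ne_zero_of_mul h)
    obtain ⟨τ, hτ, h2⟩ := exists_of_orbitCoeff_ne_zero (right_ne_zero_of_mul h)
    exact hv (h2.symm.trans ((hw.eq_of_orbits hrk hinj hw hρ hτ (h1.trans h2.symm)).2 rfl).2)
  · simp

/-- The pairing of semistandard words is unitriangular. -/
theorem det_orbitPairing [Fintype ι] [Fintype {w // Semistandard p rk row col w}]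
    [DecidableEq {w // Semistandard p rk row col w}] (hrk : Function.Injective rk)
    (hinj : ∀ r s, row r = row s → col r = col s → r = s) :
    (Matrix.of fun u w : {w // Semistandard p rk row col w} =>
      orbitPairing p row col u.1 w.1).det = 1 := by
  let e := Fintype.equivFin {w // Semistandard p rk row col w}
  let φ : {w // Semistandard p rk row col w} → ℕ ×ₗ Fin _ :=
    -- Ties in the statistic may be broken arbitrarily: a nonzero pairing between words with equal
    -- statistic forces the words to coincide.
    fun w => toLex (∑ r, row r * rk (w.1 r), e w)
  let _ : LinearOrder {w // Semistandard p rk row col w} := LinearOrder.lift' φ fun u w h =>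
    e.injective (congr_arg Prod.snd (toLex.injective h))
  convert Matrix.det_of_isUpperTriangular (M := Matrix.of fun u w :
    {w // Semistandard p rk row col w} => orbitPairing p row col u.1 w.1) ?_
  · exact (Finset.prod_eq_one fun w _ => w.2.orbitPairing_self hrk hinj).symm
  · intro u w hlt
    by_contra h
    obtain ⟨v, -, hv⟩ := Finset.exists_ne_zero_of_sum_ne_zero h
    obtain ⟨ρ, hρ, h1⟩ := exists_of_orbitCoeff_ne_zero (left_ne_zero_of_mul hv)
    obtain ⟨τ, hτ, h2⟩ := exists_of_orbitCoeff_ne_zero (right_ne_zero_of_mul hv)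
    obtain ⟨h3, h4⟩ := u.2.eq_of_orbits hrk hinj w.2 hρ hτ (h1.trans h2.symm)
    have hlt : φ w < φ u := hlt
    rw [Prod.Lex.toLex_lt_toLex] at hlt
    rcases hlt with h5 | ⟨h5, h6⟩
    · exact absurd h5 h3.not_gt
    · exact absurd h6 (by rw [Subtype.ext (h4 h5.symm).1]; exact lt_irrefl _)

end semistandard

/-! ### Sorting and exchange arguments for weighted sums -/

section sums

variable {d : ℕ}

theorem sum_mul_swap (o f : Fin d → ℕ) (a b : Fin d) :
    (∑ x, (o x : ℤ) * f (Equiv.swap a b x)) =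
      ∑ x, (o x : ℤ) * f x + ((o b : ℤ) - o a) * (f a - f b) := by
  by_cases hab : a = b
  · subst hab
    simp
  rw [← sub_eq_iff_eq_add', ← Finset.sum_sub_distrib, Fintype.sum_eq_add a b hab]
  · rw [Equiv.swap_apply_left, Equiv.swap_apply_right]
    ring
  · intro x hx
    rw [Equiv.swap_apply_of_ne_of_ne hx.1 hx.2, sub_self]

theorem swap_mem_youngSubgroup {b : Fin d → ℕ} {r s : Fin d} (h : b r = b s) :
    Equiv.swap r s ∈ youngSubgroup b := by
  intro x
  rw [Equiv.swap_apply_def]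
  split_ifs with h1 h2
  · rw [h1, h]
  · rw [h2, h]
  · rfl

theorem exists_lt_apply_of_perm {b : Fin d → ℕ} {σ : Equiv.Perm (Fin d)}
    (hσ : σ ∉ youngSubgroup b) : ∃ r, b r < b (σ r) := by
  by_contra! h
  refine hσ fun r => ?_
  exact (Finset.sum_eq_sum_iff_of_le fun r _ => h r).1 (Equiv.sum_comp σ b) r (Finset.mem_univ r)

theorem exists_apply_lt_of_perm {b : Fin d → ℕ} {σ : Equiv.Perm (Fin d)}
    (hσ : σ ∉ youngSubgroup b) : ∃ r, b (σ r) < b r := by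
  by_contra! h
  refine hσ fun r => ?_
  exact ((Finset.sum_eq_sum_iff_of_le fun r _ => h r).1 (Equiv.sum_comp σ b).symm r
    (Finset.mem_univ r)).symm

/-- Every function can be sorted within the blocks of `b`. -/
theorem exists_sorted (b o f : Fin d → ℕ) :
    ∃ τ ∈ youngSubgroup b, ∀ r s, b r = b s → o r < o s → f (τ r) ≤ f (τ s) := by
  classical
  -- A maximizer of ∑ o · (f ∘ τ) is sorted, since swapping a pair in the wrong order would increase
  -- the sum.
  obtain ⟨τ, hτ, hmax⟩ := Finset.exists_max_image
    (Finset.univ.filter fun τ => τ ∈ youngSubgroup b)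
    (fun τ => ∑ x, (o x : ℤ) * f (τ x)) ⟨1, by simp⟩
  simp only [Finset.mem_filter, Finset.mem_univ, true_and] at hτ hmax
  refine ⟨τ, hτ, fun r s hb ho => ?_⟩
  have hswap : Equiv.swap r s ∈ youngSubgroup b := swap_mem_youngSubgroup hb
  have h1 := hmax _ (Subgroup.mul_mem _ hτ hswap)
  have h2 := sum_mul_swap o (f ∘ τ) r s
  simp only [Function.comp_apply] at h2
  simp only [Equiv.Perm.mul_apply, h2] at h1
  zify at ho ⊢
  by_contra! h3
  nlinarith

/-- Moving the larger values of `f` between two blocks of `b` can only increase `∑ b f`. -/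
theorem lt_sum_or_exists_eq {b f : Fin d → ℕ} {C : Finset (Fin d)} {j j' : ℕ} (hj : j < j')
    (hC : ∀ r ∈ C, b r = j ∨ b r = j')
    (hf : ∀ r ∈ C, ∀ s ∈ C, b r = j → b s = j' → f s ≤ f r) {σ : Equiv.Perm (Fin d)}
    (hσ : ∀ r ∉ C, σ r = r) :
    ∑ r, (b r : ℤ) * f r < ∑ r, (b r : ℤ) * f (σ r) ∨
      ∃ τ ∈ youngSubgroup b, (∀ r ∉ C, τ r = r) ∧ ∀ r, f (σ r) = f (τ r) := by
  classical
  -- Induction on the number of positions that σ moves to the other block. If there are any, some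
  -- `r` crosses from j to j' and some `s` crosses back, and `σ * swap r s` undoes both crossings.
  induction hN : (Finset.univ.filter fun r => b (σ r) ≠ b r).card using Nat.strong_induction_on
    generalizing σ with
  | _ N ih =>
  by_cases hmem : σ ∈ youngSubgroup b
  · exact Or.inr ⟨σ, hmem, hσ, fun _ => rfl⟩
  obtain ⟨r, hr⟩ := exists_lt_apply_of_perm hmem
  obtain ⟨s, hs⟩ := exists_apply_lt_of_perm hmem
  have hCσ : ∀ x, b (σ x) ≠ b x → x ∈ C ∧ σ x ∈ C := by
    intro x hx
    constructor
    · by_contra h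
      exact hx (by rw [hσ x h])
    · by_contra h
      exact hx (by rw [σ.injective (hσ _ h)])
  obtain ⟨hrC, hrC'⟩ := hCσ r hr.ne'
  obtain ⟨hsC, hsC'⟩ := hCσ s hs.ne
  have h1 := hC _ hrC
  have h2 := hC _ hrC'
  have h3 := hC _ hsC
  have h4 := hC _ hsC'
  have h5 : b r = j := by omega
  have h6 : b (σ r) = j' := by omega
  have h7 : b s = j' := by omega
  have h8 : b (σ s) = j := by omega
  have hσ' : ∀ x ∉ C, (σ * Equiv.swap r s) x = x := by
    intro x hx
    rw [Equiv.Perm.mul_apply, Equiv.swap_apply_of_ne_of_ne, hσ x hx]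
    · rintro rfl; exact hx hrC
    · rintro rfl; exact hx hsC
  have hlt : (Finset.univ.filter fun x => b ((σ * Equiv.swap r s) x) ≠ b x).card < N := by
    rw [← hN]
    refine Finset.card_lt_card ⟨fun x hx => ?_, fun h => ?_⟩
    · refine Finset.mem_filter.2 ⟨Finset.mem_univ _, ?_⟩
      replace hx := (Finset.mem_filter.1 hx).2
      rw [Equiv.Perm.mul_apply, Equiv.swap_apply_def] at hx
      split_ifs at hx with hxr hxs
      · exact absurd (by rw [h8, hxr, h5]) hx
      · exact absurd (by rw [h6, hxs, h7]) hx
      · exact hx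
    · have hr' := h (Finset.mem_filter.2 ⟨Finset.mem_univ r, hr.ne'⟩)
      refine (Finset.mem_filter.1 hr').2 ?_
      rw [Equiv.Perm.mul_apply, Equiv.swap_apply_left, h8, h5]
  have hle := hf _ hsC' _ hrC' h8 h6
  have hsum := sum_mul_swap b (f ∘ σ) r s
  simp only [Function.comp_apply, h5, h7] at hsum
  have hj' : (0 : ℤ) < j' - j := by omega
  -- If the exchanged values agree, `f ∘ σ` is unchanged by the swap. Otherwise the sum for σ
  -- strictly exceeds that for `σ * swap r s`, which by induction is at least the original sum.
  rcases hle.eq_or_lt with heq | hlt'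
  · have hcomp : ∀ x, f ((σ * Equiv.swap r s) x) = f (σ x) := by
      intro x
      rw [Equiv.Perm.mul_apply, Equiv.swap_apply_def]
      split_ifs with hxr hxs
      · rw [hxr, heq]
      · rw [hxs, heq]
      · rfl
    have h := ih _ hlt hσ' rfl
    simpa only [hcomp] using h
  · left
    have hpos : (0 : ℤ) < (j' - j) * (f (σ s) - f (σ r)) := mul_pos hj' (by omega)
    rcases ih _ hlt hσ' rfl with h | ⟨τ, hτ, -, h⟩
    · simp only [Equiv.Perm.mul_apply] at h
      linarith
    · simp only [Equiv.Perm.mul_apply] at h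
      simp only [h] at hsum
      have h9 : ∑ x, (b x : ℤ) * f (τ x) = ∑ x, (b x : ℤ) * f x := by
        exact_mod_cast sum_comp_eq_of_mem (f := f) hτ
      linarith

end sums

/-! ### Column sums and Garnir relations over ℚ -/

section garnir

variable {ι : Type*} {d : ℕ} (p : ι → ZMod 2) (row col : Fin d → ℕ)

instance (b : Fin d → ℕ) : DecidablePred (· ∈ youngSubgroup b) :=
  fun σ => inferInstanceAs (Decidable (∀ r, b (σ r) = b r))

/-- The twisted sum over the column group applied to a word, as a functional on row equivariant
functions. -/
def columnSum (w : Fin d → ι)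
    (g : {g : (Fin d → ι) → ℚ // Equivariant (superSign p) (youngSubgroup row) g}) : ℚ :=
  ∑ τ with τ ∈ youngSubgroup col, ((twistedSign p w τ : ℤ) : ℚ) * g.1 (w ∘ τ)

variable {p row col}

theorem intCast_units_mul_self {k : Type*} [Ring k] (x : ℤˣ) :
    ((x : ℤ) : k) * ((x : ℤ) : k) = 1 := by
  rw [← Int.cast_mul, ← Units.val_mul, Int.units_mul_self]
  simp

theorem columnSum_comp (w : Fin d → ι) {π : Equiv.Perm (Fin d)} (hπ : π ∈ youngSubgroup col) :
    columnSum p row col (w ∘ π) = ((twistedSign p w π : ℤ) : ℚ) • columnSum p row col w := by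
  funext g
  rw [Pi.smul_apply, columnSum, columnSum, smul_eq_mul, Finset.mul_sum]
  refine Finset.sum_equiv (Equiv.mulLeft π) (fun τ => ?_) fun τ _ => ?_
  · simp only [Finset.mem_filter, Finset.mem_univ, true_and, Equiv.coe_mulLeft]
    exact (Subgroup.mul_mem_cancel_left _ hπ).symm
  · rw [Equiv.coe_mulLeft, twistedSign_mul, Equiv.Perm.coe_mul, Function.comp_assoc]
    push_cast
    linear_combination -(((twistedSign p (w ∘ π) τ : ℤ) : ℚ) * g.1 (w ∘ π ∘ τ)) *
      intCast_units_mul_self (k := ℚ) (twistedSign p w π)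

/-- The Garnir relation attached to a set `C` of positions, two of which are brought into a common
row by every element of the column group. -/
theorem garnir_relation {C : Finset (Fin d)}
    (hC : ∀ τ ∈ youngSubgroup col, ∃ r s, r ≠ s ∧ row r = row s ∧ τ r ∈ C ∧ τ s ∈ C)
    (w : Fin d → ι) :
    ∑ σ : Equiv.Perm (Fin d) with ∀ r ∉ C, σ r = r,
      ((twistedSign p w σ : ℤ) : ℚ) • columnSum p row col (w ∘ σ) = 0 := by
  funext g
  simp only [Finset.sum_apply, Pi.smul_apply, columnSum, smul_eq_mul, Finset.mul_sum, Pi.zero_apply]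
  rw [Finset.sum_comm]
  refine Finset.sum_eq_zero fun τ hτ => ?_
  obtain ⟨r, s, hrs, hrow, hr, hs⟩ := hC τ (by simpa using hτ)
  have hswap : Equiv.swap (τ r) (τ s) * τ = τ * Equiv.swap r s :=
    (Equiv.mul_swap_eq_swap_mul τ r s).symm
  have hmem : Equiv.swap r s ∈ youngSubgroup row := swap_mem_youngSubgroup hrow
  -- For fixed τ, multiplying σ by the swap of `τ r` and `τ s` amounts to acting after `σ * τ` by a
  -- swap within a row. There `g` contributes the super sign and the twisted sign contributes its
  -- negative, so the terms cancel in pairs.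
  refine Finset.sum_involution (fun σ _ => σ * Equiv.swap (τ r) (τ s)) ?_ ?_ ?_ ?_
  · intro σ _
    have h1 : ∀ σ : Equiv.Perm (Fin d), ((twistedSign p w σ : ℤ) : ℚ) *
        (((twistedSign p (w ∘ σ) τ : ℤ) : ℚ) * g.1 ((w ∘ σ) ∘ τ)) =
        ((twistedSign p w (σ * τ) : ℤ) : ℚ) * g.1 (w ∘ (σ * τ : Equiv.Perm (Fin d))) := by
      intro σ
      rw [twistedSign_mul, Equiv.Perm.coe_mul, Function.comp_assoc]
      push_cast
      ring
    rw [h1, h1, mul_assoc, hswap, ← mul_assoc, twistedSign_mul p w (σ * τ),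
      Equiv.Perm.coe_mul (σ * τ), ← Function.comp_assoc, g.2 _ _ hmem,
      twistedSign.eq_1 p _ (Equiv.swap r s), Equiv.Perm.sign_swap hrs]
    generalize w ∘ (σ * τ : Equiv.Perm (Fin d)) = v
    push_cast
    linear_combination (-((twistedSign p w (σ * τ) : ℤ) : ℚ) * g.1 v) *
      intCast_units_mul_self (k := ℚ) (superSign p v (Equiv.swap r s))
  · intro σ _ _ h
    have h1 : Equiv.swap (τ r) (τ s) = 1 := by simpa using h
    exact hrs (τ.injective (Equiv.swap_eq_one_iff.1 h1))
  · intro σ hσ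
    simp only [Finset.mem_filter, Finset.mem_univ, true_and] at hσ ⊢
    intro x hx
    rw [Equiv.Perm.mul_apply, Equiv.swap_apply_of_ne_of_ne, hσ x hx]
    · rintro rfl; exact hx hr
    · rintro rfl; exact hx hs
  · intro σ _
    rw [mul_assoc, Equiv.swap_mul_self, mul_one]

/-- Swapping two equal even letters of a column fixes the word but has twisted sign -1, so the
column sum is its own negative. -/
theorem columnSum_eq_zero {w : Fin d → ι} {r s : Fin d} (hrs : r ≠ s) (hcol : col r = col s)
    (hw : w r = w s) (hp : p (w r) = 0) : columnSum p row col w = 0 := by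
  have hmem : Equiv.swap r s ∈ youngSubgroup col := swap_mem_youngSubgroup hcol
  have hcomp : w ∘ Equiv.swap r s = w := by
    funext x
    rw [Function.comp_apply, Equiv.swap_apply_def]
    split_ifs with h1 h2
    · rw [h1, hw]
    · rw [h2, hw]
    · rfl
  have h1 := columnSum_comp (p := p) (row := row) w hmem
  have h2 : superSign p w (Equiv.swap r s) = 1 := by
    refine superSign_eq_one p w _ fun x hx => Equiv.swap_apply_of_ne_of_ne ?_ ?_
    · rintro rfl; exact hx hp
    · rintro rfl; exact hx (hw ▸ hp)
  rw [hcomp, twistedSign, h2, Equiv.Perm.sign_swap hrs] at h1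
  funext g
  have h3 := congr_fun h1 g
  simp only [Pi.smul_apply, smul_eq_mul] at h3
  push_cast at h3
  simp only [Pi.zero_apply]
  linarith

end garnir

/-! ### Straightening column sums into semistandard ones -/

section straightening

variable (lam : YoungDiagram)

/-- The column of the cell at a position of the row reading. -/
def cellCol (r : Fin lam.card) : ℕ := (rowReading lam r).1.2

variable {lam}

theorem rowReading_ext (r s : Fin lam.card) (h : rowBlock lam r = rowBlock lam s)
    (h' : cellCol lam r = cellCol lam s) : r = s :=
  (rowReading lam).injective (Subtype.ext (Prod.ext h h'))

theorem mem_of_position (r : Fin lam.card) : (rowBlock lam r, cellCol lam r) ∈ lam :=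
  (YoungDiagram.mem_cells _).1 (rowReading lam r).2

theorem exists_position {i j : ℕ} (h : (i, j) ∈ lam) :
    ∃ r, rowBlock lam r = i ∧ cellCol lam r = j := by
  refine ⟨(rowReading lam).symm ⟨(i, j), (YoungDiagram.mem_cells _).2 h⟩, ?_, ?_⟩ <;>
    simp [rowBlock, cellCol]

variable (lam) in
/-- The Garnir positions: column `j` from row `i` on, and column `j'` up to row `i`. -/
def garnirSet (i j j' : ℕ) : Finset (Fin lam.card) :=
  {r | cellCol lam r = j ∧ i ≤ rowBlock lam r ∨ cellCol lam r = j' ∧ rowBlock lam r ≤ i}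

theorem mem_garnirSet {i j j' : ℕ} {r : Fin lam.card} : r ∈ garnirSet lam i j j' ↔
    cellCol lam r = j ∧ i ≤ rowBlock lam r ∨ cellCol lam r = j' ∧ rowBlock lam r ≤ i := by
  simp [garnirSet]

/-- Pigeonhole: the Garnir set has one position more than column `j` has cells, because row `i` is
counted in both columns. A column permutation leaves these positions in columns of length at most
that of column `j`. -/
theorem exists_row_eq_of_garnirSet {i j j' : ℕ} (hj : j < j') (hij : (i, j') ∈ lam)
    (τ : Equiv.Perm (Fin lam.card)) (hτ : τ ∈ youngSubgroup (cellCol lam)) :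
    ∃ r s, r ≠ s ∧ rowBlock lam r = rowBlock lam s ∧
      τ r ∈ garnirSet lam i j j' ∧ τ s ∈ garnirSet lam i j j' := by
  -- The Garnir positions are listed as rows 0, …, i of column `j'`, then rows i, i + 1, … of column
  -- `j`; the shift to t - 1 repeats row i. Values beyond the range are arbitrary.
  have hpos : ∀ t : ℕ, ∃ r, t < lam.colLen j + 1 →
      (t ≤ i ∧ cellCol lam r = j' ∧ rowBlock lam r = t) ∨
      (i < t ∧ cellCol lam r = j ∧ rowBlock lam r = t - 1) := by
    intro t
    rcases le_or_gt t i with h | h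
    · obtain ⟨r, h1, h2⟩ := exists_position (lam.up_left_mem h le_rfl hij)
      exact ⟨r, fun _ => Or.inl ⟨h, h2, h1⟩⟩
    · by_cases ht : t < lam.colLen j + 1
      · obtain ⟨r, h1, h2⟩ := exists_position (lam := lam) (i := t - 1) (j := j)
          (YoungDiagram.mem_iff_lt_colLen.2 (by omega))
        exact ⟨r, fun _ => Or.inr ⟨h, h2, h1⟩⟩
      · obtain ⟨r, -⟩ := exists_position hij
        exact ⟨r, fun h => absurd h ht⟩
  choose f hf using hpos
  have hcol : ∀ r, cellCol lam (τ⁻¹ r) = cellCol lam r := Subgroup.inv_mem _ hτ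
  have hC : ∀ t < lam.colLen j + 1, f t ∈ garnirSet lam i j j' := by
    intro t ht
    rw [mem_garnirSet]
    have := hf t ht
    omega
  obtain ⟨t, ht, t', ht', hne, heq⟩ := Finset.exists_ne_map_eq_of_card_lt_of_maps_to
    (s := Finset.range (lam.colLen j + 1)) (t := Finset.range (lam.colLen j)) (by simp)
    (f := fun t => rowBlock lam (τ⁻¹ (f t))) (fun t ht => by
      have h1 := YoungDiagram.mem_iff_lt_colLen.1 (mem_of_position (τ⁻¹ (f t)))
      have h2 := lam.colLen_anti j j' hj.le
      have h3 := hf t (by simpa using ht)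
      rw [hcol] at h1
      simp only [Finset.coe_range, Set.mem_Iio]
      rcases h3 with ⟨-, h3, -⟩ | ⟨-, h3, -⟩ <;> rw [h3] at h1 <;> omega)
  simp only [Finset.mem_range] at ht ht'
  refine ⟨τ⁻¹ (f t), τ⁻¹ (f t'), fun h => hne ?_, heq, ?_, ?_⟩
  · have h1 : f t = f t' := τ⁻¹.injective h
    have h2 := hf t ht
    have h3 := hf t' ht'
    rw [h1] at h2
    omega
  · rw [show τ (τ⁻¹ (f t)) = f t from τ.apply_symm_apply _]
    exact hC t ht
  · rw [show τ (τ⁻¹ (f t')) = f t' from τ.apply_symm_apply _]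
    exact hC t' ht'

variable {ι : Type*} {p : ι → ZMod 2} {rk : ι → ℕ}

/-- The column sum of a column sorted word with a violation of the row condition is a combination
of column sums of words with larger `∑ col * rk`. -/
theorem columnSum_mem_of_violation (hrk : Function.Injective rk) {w : Fin lam.card → ι}
    (hcol : ∀ r s, cellCol lam r = cellCol lam s → rowBlock lam r < rowBlock lam s →
      rk (w r) < rk (w s) ∨ w r = w s ∧ p (w r) ≠ 0)
    {r₀ s₀ : Fin lam.card} (hrow : rowBlock lam r₀ = rowBlock lam s₀)
    (hlt : cellCol lam r₀ < cellCol lam s₀)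
    (hv : ¬(rk (w r₀) < rk (w s₀) ∨ w r₀ = w s₀ ∧ p (w r₀) = 0))
    {N : Submodule ℚ
      ({g : (Fin lam.card → ι) → ℚ // Equivariant (superSign p) (youngSubgroup (rowBlock lam)) g} →
        ℚ)}
    (hN : ∀ v : Fin lam.card → ι, ∑ r, (cellCol lam r : ℤ) * rk (w r) <
      ∑ r, (cellCol lam r : ℤ) * rk (v r) →
        columnSum p (rowBlock lam) (cellCol lam) v ∈ N) :
    columnSum p (rowBlock lam) (cellCol lam) w ∈ N := by
  classical
  set C := garnirSet lam (rowBlock lam r₀) (cellCol lam r₀) (cellCol lam s₀) with hCdef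
  have hcolle : ∀ r s, cellCol lam r = cellCol lam s → rowBlock lam r ≤ rowBlock lam s →
      rk (w r) ≤ rk (w s) := by
    intro r s h h'
    rcases h'.eq_or_lt with h1 | h1
    · rw [rowReading_ext r s h1 h]
    · rcases hcol r s h h1 with h2 | h2
      · exact h2.le
      · rw [h2.1]
  have hcolne : ∀ r s, cellCol lam r = cellCol lam s → r ≠ s → w r = w s → p (w r) ≠ 0 := by
    intro r s h h' heq
    rcases lt_trichotomy (rowBlock lam r) (rowBlock lam s) with h1 | h1 | h1
    · rcases hcol r s h h1 with h2 | h2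
      · rw [heq] at h2; exact absurd h2 (lt_irrefl _)
      · exact h2.2
    · exact absurd (rowReading_ext r s h1 h) h'
    · rcases hcol s r h.symm h1 with h2 | h2
      · rw [heq] at h2; exact absurd h2 (lt_irrefl _)
      · rw [heq]; exact h2.2
  have hCcol : ∀ r ∈ C, cellCol lam r = cellCol lam r₀ ∨ cellCol lam r = cellCol lam s₀ := by
    intro r hr
    rw [hCdef, mem_garnirSet] at hr
    tauto
  have hv1 : rk (w s₀) ≤ rk (w r₀) := not_lt.1 fun h => hv (Or.inl h)
  have hCA : ∀ r ∈ C, cellCol lam r = cellCol lam r₀ → rk (w r₀) ≤ rk (w r) := by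
    intro r hr h1
    rw [hCdef, mem_garnirSet] at hr
    exact hcolle r₀ r h1.symm (by omega)
  have hCB : ∀ r ∈ C, cellCol lam r = cellCol lam s₀ → rk (w r) ≤ rk (w s₀) := by
    intro r hr h1
    rw [hCdef, mem_garnirSet] at hr
    exact hcolle r s₀ h1 (by omega)
  -- A letter common to both columns of C is squeezed between `w s₀` and `w r₀`, so it equals both;
  -- the violation then says that it is odd.
  have hmixed : ∀ r ∈ C, ∀ s ∈ C, cellCol lam r = cellCol lam r₀ → cellCol lam s = cellCol lam s₀ →
      w r = w s → p (w r) ≠ 0 := by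
    intro r hr s hs h1 h2 h3 h4
    have h5 := hCA r hr h1
    have h6 := hCB s hs h2
    rw [← h3] at h6
    have h7 : w r = w r₀ := hrk (by omega)
    have h8 : w r = w s₀ := hrk (by omega)
    exact hv (Or.inr ⟨h7.symm.trans h8, h7 ▸ h4⟩)
  have hstab : ∀ π : Equiv.Perm (Fin lam.card), (∀ r ∉ C, π r = r) → w ∘ π = w →
      twistedSign p w π = 1 := by
    intro π hπ hwπ
    refine twistedSign_eq_one p w π hwπ fun t ht => ?_
    by_contra hne
    have hwt : w (π t) = w t := congr_fun hwπ t
    have htC : t ∈ C := by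
      by_contra h
      exact hne (hπ t h)
    have htC' : π t ∈ C := by
      by_contra h
      exact hne (π.injective (hπ _ h))
    rcases hCcol t htC with h1 | h1 <;> rcases hCcol _ htC' with h2 | h2
    · exact hcolne t (π t) (h1.trans h2.symm) (Ne.symm hne) hwt.symm ht
    · exact hmixed t htC _ htC' h1 h2 hwt.symm ht
    · exact hmixed _ htC' t htC h2 h1 hwt (hwt ▸ ht)
    · exact hcolne t (π t) (h1.trans h2.symm) (Ne.symm hne) hwt.symm ht
  have hij : (rowBlock lam r₀, cellCol lam s₀) ∈ lam := hrow ▸ mem_of_position s₀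
  have hgar := garnir_relation (p := p) (exists_row_eq_of_garnirSet hlt hij) w
  rw [← hCdef] at hgar
  -- The Garnir relation is split according to whether σ raises ∑ col · rank. All terms that do not
  -- raise it equal the column sum of `w`. Their number is nonzero, since σ = 1 is among them, and
  -- is inverted in ℚ.
  have hsplit := Finset.sum_filter_add_sum_filter_not
    (Finset.univ.filter fun σ : Equiv.Perm (Fin lam.card) => ∀ r ∉ C, σ r = r)
    (fun σ => ∑ r, (cellCol lam r : ℤ) * rk (w r) < ∑ r, (cellCol lam r : ℤ) * rk (w (σ r)))
    fun σ => ((twistedSign p w σ : ℤ) : ℚ) •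
      columnSum p (rowBlock lam) (cellCol lam) (w ∘ σ)
  rw [hgar, add_comm, Finset.sum_congr rfl (g := fun _ =>
      columnSum p (rowBlock lam) (cellCol lam) w), Finset.sum_const, add_eq_zero_iff_eq_neg,
    ← Nat.cast_smul_eq_nsmul ℚ] at hsplit
  · have hdiv : ∀ c : ℚ, c ≠ 0 → c • columnSum p (rowBlock lam) (cellCol lam) w ∈ N →
        columnSum p (rowBlock lam) (cellCol lam) w ∈ N := fun c hc => (N.smul_mem_iff hc).1
    refine hdiv _ ?_ ((congr_arg (· ∈ N) hsplit).mpr ?_)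
    · rw [Nat.cast_ne_zero, Finset.card_ne_zero]
      exact ⟨1, by simp⟩
    · refine Submodule.neg_mem _ (Submodule.sum_mem _ fun σ hσ => Submodule.smul_mem _ _ ?_)
      exact hN _ (Finset.mem_filter.1 hσ).2
  · intro σ hσ
    simp only [Finset.mem_filter, Finset.mem_univ, true_and] at hσ
    -- Without an increase, `w ∘ σ` is also obtained from a column permutation τ supported on C.
    -- Then σ τ⁻¹ stabilizes `w` with twisted sign 1, so the two signs agree.
    obtain ⟨τ, hτ, hτC, hστ⟩ := (lt_sum_or_exists_eq (f := fun r => rk (w r)) hlt hCcol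
      (fun r hr s hs h1 h2 => (hCB s hs h2).trans (hv1.trans (hCA r hr h1))) hσ.1).resolve_left
      hσ.2
    have hw : w ∘ σ = w ∘ τ := funext fun r => hrk (hστ r)
    have hπ : w ∘ (σ * τ⁻¹ : Equiv.Perm _) = w := by
      rw [Equiv.Perm.coe_mul, ← Function.comp_assoc, hw, comp_comp_inv]
    have hτinv : ∀ r ∉ C, τ⁻¹ r = r := fun r hr =>
      (Equiv.symm_apply_eq τ).2 (hτC r hr).symm
    have h1 := twistedSign_mul p w (σ * τ⁻¹) τ
    rw [inv_mul_cancel_right, hπ, hstab _ (fun r hr => by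
      rw [Equiv.Perm.mul_apply, hτinv r hr, hσ.1 r hr]) hπ, one_mul] at h1
    rw [h1, hw, columnSum_comp _ hτ, smul_smul, intCast_units_mul_self, one_smul]

/-- Straightening: the column sums are spanned by those of semistandard words. -/
theorem columnSum_mem_span [Finite ι] (hrk : Function.Injective rk) (w : Fin lam.card → ι) :
    columnSum p (rowBlock lam) (cellCol lam) w ∈ Submodule.span ℚ (Set.range
      fun S : {S // Semistandard p rk (rowBlock lam) (cellCol lam) S} =>
        columnSum p (rowBlock lam) (cellCol lam) S.1) := by
  -- There are finitely many words, so ∑ col · rank is bounded and its distance from the bound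
  -- serves as induction measure. Sorting the columns leaves it unchanged.
  obtain ⟨B, hB⟩ := (Set.finite_range fun w : Fin lam.card → ι =>
    ∑ r, (cellCol lam r : ℤ) * rk (w r)).bddAbove
  replace hB : ∀ w : Fin lam.card → ι, ∑ r, (cellCol lam r : ℤ) * rk (w r) ≤ B :=
    fun w => hB ⟨w, rfl⟩
  induction hN : (B - ∑ r, (cellCol lam r : ℤ) * rk (w r)).toNat using Nat.strong_induction_on
    generalizing w with
  | _ N ih =>
  obtain ⟨τ, hτ, hsort⟩ := exists_sorted (cellCol lam) (rowBlock lam) fun r => rk (w r)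
  have hsum : ∑ r, (cellCol lam r : ℤ) * rk ((w ∘ τ) r) = ∑ r, (cellCol lam r : ℤ) * rk (w r) := by
    exact_mod_cast sum_comp_eq_of_mem (f := fun r => rk (w r)) hτ
  have h1 : columnSum p (rowBlock lam) (cellCol lam) w = ((twistedSign p w τ : ℤ) : ℚ) •
      columnSum p (rowBlock lam) (cellCol lam) (w ∘ τ) := by
    rw [columnSum_comp _ hτ, smul_smul, intCast_units_mul_self, one_smul]
  rw [h1]
  refine Submodule.smul_mem _ _ ?_
  rw [← hsum] at hN
  simp only [← Function.comp_apply (f := w)] at hsort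
  generalize w ∘ τ = v at hsort hN ⊢
  by_cases hcol : ∀ r s, cellCol lam r = cellCol lam s → rowBlock lam r < rowBlock lam s →
      rk (v r) < rk (v s) ∨ v r = v s ∧ p (v r) ≠ 0
  · by_cases hrow : ∀ r s, rowBlock lam r = rowBlock lam s → cellCol lam r < cellCol lam s →
        rk (v r) < rk (v s) ∨ v r = v s ∧ p (v r) = 0
    · exact Submodule.subset_span ⟨⟨v, hrow, hcol⟩, rfl⟩
    · push Not at hrow
      obtain ⟨r, s, h2, h3, h4, h5⟩ := hrow
      refine columnSum_mem_of_violation hrk hcol h2 h3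
        (fun h => h.elim h4.not_gt fun h => h5 h.1 h.2) fun u hu => ih _ ?_ u rfl
      have := hB u
      omega
  · push Not at hcol
    -- In a word with sorted columns, the column condition can fail only through two equal even
    -- letters, which make the column sum vanish.
    obtain ⟨r, s, h2, h3, h4, h5⟩ := hcol
    have h6 : v r = v s := hrk ((hsort r s h2 h3).antisymm h4)
    rw [columnSum_eq_zero (fun h => h3.ne (congr_arg _ h)) h2 h6 (h5 h6)]
    exact Submodule.zero_mem _

end straightening

/-! ### Integrality of the straightening coefficients -/

section integrality

variable {ι : Type*} {p : ι → ZMod 2}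

/-- A sum over a column group is the order of the stabilizer times the sum over the orbit. -/
theorem columnSum_eq_card_mul [Fintype ι] {d : ℕ} {row col : Fin d → ℕ} {w : Fin d → ι}
    (hw : Admissible (twistedSign p) (youngSubgroup col) w) :
    ∃ N : ℚ, N ≠ 0 ∧
      ∀ g : {g : (Fin d → ι) → ℚ // Equivariant (superSign p) (youngSubgroup row) g},
        columnSum p row col w g =
          N * ∑ v, g.1 v * (orbitCoeff (twistedSign p) (youngSubgroup col) w v : ℚ) := by
  classical
  refine ⟨((Finset.univ.filter fun τ : Equiv.Perm (Fin d) =>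
    τ ∈ youngSubgroup col ∧ w ∘ τ = w).card : ℚ), ?_, fun g => ?_⟩
  · rw [Nat.cast_ne_zero, Finset.card_ne_zero]
    exact ⟨1, by simp⟩
  rw [columnSum, Finset.mul_sum]
  have h1 : ∀ τ ∈ Finset.univ.filter fun τ : Equiv.Perm (Fin d) => τ ∈ youngSubgroup col,
      ((twistedSign p w τ : ℤ) : ℚ) * g.1 (w ∘ τ) =
        (fun v => (orbitCoeff (twistedSign p) (youngSubgroup col) w v : ℚ) * g.1 v) (w ∘ τ) := by
    intro τ hτ
    simp only [Finset.mem_filter, Finset.mem_univ, true_and] at hτ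
    beta_reduce
    rw [orbitCoeff_comp_self (twistedSign_mul p) hw hτ]
  rw [Finset.sum_congr rfl h1, ← Finset.sum_fiberwise' _ (fun τ : Equiv.Perm (Fin d) => w ∘ τ)
      fun v => (orbitCoeff (twistedSign p) (youngSubgroup col) w v : ℚ) * g.1 v]
  refine Finset.sum_congr rfl fun v _ => ?_
  rw [Finset.sum_const, nsmul_eq_mul, Finset.filter_filter]
  by_cases h : orbitCoeff (twistedSign p) (youngSubgroup col) w v = 0
  · simp [h]
  obtain ⟨σ, hσ, rfl⟩ := exists_of_orbitCoeff_ne_zero h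
  rw [mul_comm (g.1 _)]
  congr 2
  refine Finset.card_bij' (fun τ _ => τ * σ⁻¹) (fun τ _ => τ * σ) ?_ ?_ ?_ ?_
  · intro τ hτ
    simp only [Finset.mem_filter, Finset.mem_univ, true_and] at hτ ⊢
    exact ⟨Subgroup.mul_mem _ hτ.1 (Subgroup.inv_mem _ hσ), by
      rw [Equiv.Perm.coe_mul, ← Function.comp_assoc, hτ.2, comp_comp_inv]⟩
  · intro τ hτ
    simp only [Finset.mem_filter, Finset.mem_univ, true_and] at hτ ⊢
    exact ⟨Subgroup.mul_mem _ hτ.1 hσ, by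
      rw [Equiv.Perm.coe_mul, ← Function.comp_assoc, hτ.2]⟩
  · intro τ _
    exact inv_mul_cancel_right _ _
  · intro τ _
    exact mul_inv_cancel_right _ _

variable {lam : YoungDiagram} {rk : ι → ℕ}

/-- Integral straightening: the pairings with a column orbit sum are integral combinations of the
pairings with those of semistandard words. -/
theorem exists_orbitPairing_eq [Fintype ι]
    [Fintype {S // Semistandard p rk (rowBlock lam) (cellCol lam) S}]
    (hrk : Function.Injective rk) {w : Fin lam.card → ι}
    (hw : Admissible (twistedSign p) (youngSubgroup (cellCol lam)) w) :
    ∃ q : {S // Semistandard p rk (rowBlock lam) (cellCol lam) S} → ℤ,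
      ∀ u, Admissible (superSign p) (youngSubgroup (rowBlock lam)) u →
        orbitPairing p (rowBlock lam) (cellCol lam) u w =
          ∑ S, q S * orbitPairing p (rowBlock lam) (cellCol lam) u S.1 := by
  classical
  obtain ⟨c, hc⟩ := (Submodule.mem_span_range_iff_exists_fun ℚ).1
    (columnSum_mem_span (p := p) hrk w)
  have hdet := det_orbitPairing (p := p) hrk (rowReading_ext (lam := lam))
  set M : Matrix {S // Semistandard p rk (rowBlock lam) (cellCol lam) S}
    {S // Semistandard p rk (rowBlock lam) (cellCol lam) S} ℤ :=
    Matrix.of fun u w => orbitPairing p (rowBlock lam) (cellCol lam) u.1 w.1 with hM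
  obtain ⟨N, hN, hcol⟩ := columnSum_eq_card_mul (row := rowBlock lam) hw
  have hex := fun S : {S // Semistandard p rk (rowBlock lam) (cellCol lam) S} =>
    columnSum_eq_card_mul (row := rowBlock lam) (S.2.admissible_col rowReading_ext)
  choose N' hN' hcol' using hex
  have hpair : ∀ u v, (orbitPairing p (rowBlock lam) (cellCol lam) u v : ℚ) =
      ∑ x, (orbitCoeff (superSign p) (youngSubgroup (rowBlock lam)) u x : ℚ) *
        (orbitCoeff (twistedSign p) (youngSubgroup (cellCol lam)) v x : ℚ) := by
    intro u v
    rw [orbitPairing]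
    push_cast
    rfl
  -- Rational straightening, evaluated on row orbit functions and rescaled by the stabilizer orders.
  have hrat : ∀ u, Admissible (superSign p) (youngSubgroup (rowBlock lam)) u →
      (orbitPairing p (rowBlock lam) (cellCol lam) u w : ℚ) =
        ∑ S, c S * N' S / N * orbitPairing p (rowBlock lam) (cellCol lam) u S.1 := by
    intro u hu
    have h := congr_fun hc
      ⟨_, equivariant_orbitCoeff (k := ℚ) (superSign_mul p) hu⟩
    simp only [Finset.sum_apply, Pi.smul_apply, smul_eq_mul, hcol, hcol', ← hpair] at h
    rw [← mul_right_inj' hN, ← h, Finset.mul_sum]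
    refine Finset.sum_congr rfl fun S _ => ?_
    field_simp
  -- As det M = 1, Cramer's rule gives an integral solution of the system indexed by semistandard
  -- `u`. The rational coefficients solve the same system, so they equal `q`, and the identity
  -- extends to all admissible `u`.
  set q := M.adjugate.mulVec fun S => orbitPairing p (rowBlock lam) (cellCol lam) S.1 w with hq
  have hMq : M.mulVec q = fun S => orbitPairing p (rowBlock lam) (cellCol lam) S.1 w := by
    rw [hq, Matrix.mulVec_mulVec, Matrix.mul_adjugate, hdet, one_smul, Matrix.one_mulVec]
  have hqq : (fun S => (q S : ℚ) - c S * N' S / N) = 0 := by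
    refine Matrix.eq_zero_of_mulVec_eq_zero (M := M.map (Int.castRingHom ℚ)) ?_ ?_
    · rw [← RingHom.mapMatrix_apply, ← RingHom.map_det, hdet]
      simp
    · funext u
      have h1 : ((M.mulVec q u : ℤ) : ℚ) = _ := congr_arg _ (congr_fun hMq u)
      rw [hrat _ (u.2.admissible_row rowReading_ext)] at h1
      simp only [Matrix.mulVec, dotProduct, hM, Matrix.of_apply, Int.cast_sum, Int.cast_mul] at h1
      simp only [Matrix.mulVec, dotProduct, hM, Matrix.map_apply, Matrix.of_apply, mul_sub,
        Finset.sum_sub_distrib, Pi.zero_apply, eq_intCast, h1]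
      simp only [mul_comm, sub_self]
  refine ⟨q, fun u hu => ?_⟩
  have h1 := hrat u hu
  simp only [← sub_eq_zero.1 (congr_fun hqq _)] at h1
  exact_mod_cast h1

end integrality

/-! ### Coordinates of tensors under place permutations -/

section tensor

variable {k : Type*} [Field k] {ι : Type*} [Fintype ι] {d : ℕ} {p : ι → ZMod 2}

theorem repr_permAct (σ : Equiv.Perm (Fin d)) (z : TensorPow k ι d) (w : Fin d → ι) :
    (wordBasis k ι d).repr (permAct k p σ z) (w ∘ σ) =
      ((superSign p w σ : ℤ) : k) * (wordBasis k ι d).repr z w := by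
  classical
  have h : (wordBasis k ι d).coord (w ∘ σ) ∘ₗ permAct k p σ =
      ((superSign p w σ : ℤ) : k) • (wordBasis k ι d).coord w := by
    refine (wordBasis k ι d).ext fun v => ?_
    rw [LinearMap.comp_apply, permAct_wordBasis, LinearMap.smul_apply, Units.smul_def, map_zsmul,
      Module.Basis.coord_apply, Module.Basis.coord_apply, Module.Basis.repr_self,
      Module.Basis.repr_self]
    by_cases hv : v = w
    · simp [hv]
    · have hv' : v ∘ σ ≠ w ∘ σ := fun h => hv (σ.surjective.injective_comp_right h)
      simp [hv, hv']
  exact LinearMap.congr_fun h z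

theorem permAct_one (z : TensorPow k ι d) : permAct k p 1 z = z := by
  suffices h : permAct k p (1 : Equiv.Perm (Fin d)) = LinearMap.id (M := TensorPow k ι d) from
    LinearMap.congr_fun h z
  refine (wordBasis k ι d).ext fun w => ?_
  rw [permAct_wordBasis, superSign_eq_one p w 1 fun _ _ => rfl]
  simp

/-- A tensor is sign-invariant under a group of permutations if and only if its coordinates are
equivariant for the twisted sign. -/
theorem equivariant_repr_iff (H : Subgroup (Equiv.Perm (Fin d))) (z : TensorPow k ι d) :
    Equivariant (twistedSign p) H ((wordBasis k ι d).repr z) ↔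
      ∀ τ ∈ H, permAct k p τ z = Equiv.Perm.sign τ • z := by
  constructor
  · intro h τ hτ
    refine (wordBasis k ι d).ext_elem fun v => ?_
    obtain ⟨w, rfl⟩ : ∃ w, w ∘ τ = v := ⟨_, comp_comp_inv v τ⁻¹⟩
    rw [repr_permAct, Units.smul_def, ← Int.cast_smul_eq_zsmul k, map_smul, Finsupp.smul_apply,
      h w τ hτ, twistedSign, smul_eq_mul]
    push_cast
    linear_combination -((superSign p w τ : ℤ) : k) * (wordBasis k ι d).repr z w *
      intCast_units_mul_self (k := k) (Equiv.Perm.sign τ)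
  · intro h w τ hτ
    have h1 := repr_permAct (p := p) τ z w
    rw [h τ hτ, Units.smul_def, ← Int.cast_smul_eq_zsmul k, map_smul, Finsupp.smul_apply,
      smul_eq_mul] at h1
    rw [twistedSign]
    push_cast
    linear_combination ((Equiv.Perm.sign τ : ℤ) : k) * h1 -
      (wordBasis k ι d).repr z (w ∘ τ) * intCast_units_mul_self (k := k) (Equiv.Perm.sign τ)

end tensor

/-! ### The Schur supermodule and the dual of the coinvariants -/

section schur

variable {k : Type*} [Field k] {m n : ℕ} {lam : YoungDiagram}

theorem colBlock_sigma (r : Fin lam.card) : colBlock lam (sigma lam r) = cellCol lam r := by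
  simp [colBlock, sigma, cellCol]

/-- The Schur supermodule is the image of the tensors that are sign-invariant under permutations
of the columns. -/
theorem mem_schurSupermodule_iff (y : SymPow k m n (rowBlock lam)) :
    y ∈ SchurSupermodule k m n lam ↔
      ∃ z, Equivariant (twistedSign (parity m n)) (youngSubgroup (cellCol lam))
        ((wordBasis k (Fin m ⊕ Fin n) lam.card).repr z) ∧ symMk k m n (rowBlock lam) z = y := by
  simp only [equivariant_repr_iff]
  constructor
  · rintro ⟨⟨x, hx⟩, rfl⟩
    refine ⟨_, fun τ hτ => ?_, (theta_apply k m n lam ⟨x, hx⟩).symm⟩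
    simp only [dividedPow, Submodule.mem_iInf, LinearMap.mem_eqLocus, LinearMap.id_apply] at hx
    -- Conjugation by σ_λ carries the column group in the row reading to the Young subgroup of
    -- `colBlock` and preserves signs; the parity shift turns invariance into sign-invariance.
    have hmem : sigma lam * τ * (sigma lam)⁻¹ ∈ youngSubgroup (colBlock lam) := by
      intro r
      obtain ⟨s, rfl⟩ := (sigma lam).surjective r
      simp only [Equiv.Perm.mul_apply]
      rw [show (sigma lam)⁻¹ (sigma lam s) = s from (sigma lam).symm_apply_apply s,
        colBlock_sigma, colBlock_sigma, hτ s]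
    have h := parityShift_permAct (k := k) (parity m n) (sigma lam * τ * (sigma lam)⁻¹) x
    rw [hx _ hmem, prod_inversions_neg_one] at h
    have hs : Equiv.Perm.sign (sigma lam * τ * (sigma lam)⁻¹) = Equiv.Perm.sign τ := by
      simp only [Equiv.Perm.sign_mul, Equiv.Perm.sign_inv]
      rw [mul_comm (Equiv.Perm.sign (sigma lam)), mul_assoc, Int.units_mul_self, mul_one]
    rw [hs] at h
    change permAct k (parity m n) τ (permAct k (parity m n) (sigma lam)
      (parityShift k (parity m n) x)) = Equiv.Perm.sign τ • permAct k (parity m n) (sigma lam)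
      (parityShift k (parity m n) x)
    conv_rhs => rw [h]
    rw [Units.smul_def, Units.smul_def, map_zsmul, smul_smul, ← Units.val_mul, Int.units_mul_self,
      Units.val_one, one_smul, ← permAct_mul, ← permAct_mul, inv_mul_cancel_right]
  · rintro ⟨z, hz, rfl⟩
    have hy : permAct k (parity m n) (sigma lam)
        (permAct k (parity m n) (sigma lam)⁻¹ z) = z := by
      rw [← permAct_mul, inv_mul_cancel, permAct_one]
    refine ⟨⟨parityShift k (parity m n) (permAct k (parity m n) (sigma lam)⁻¹ z), ?_⟩, ?_⟩
    · simp only [dividedPow, Submodule.mem_iInf, LinearMap.mem_eqLocus, LinearMap.id_apply]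
      intro π hπ
      apply Function.LeftInverse.injective (parityShift_parityShift (k := k) (parity m n))
      rw [parityShift_permAct, parityShift_parityShift, prod_inversions_neg_one]
      have hmem : (sigma lam)⁻¹ * π * sigma lam ∈ youngSubgroup (cellCol lam) := by
        intro r
        rw [← colBlock_sigma, ← colBlock_sigma, Equiv.Perm.mul_apply, Equiv.Perm.mul_apply,
          show sigma lam ((sigma lam)⁻¹ (π (sigma lam r))) = π (sigma lam r) from
            (sigma lam).apply_symm_apply _, hπ]
      have h := hz _ hmem
      have hs : Equiv.Perm.sign ((sigma lam)⁻¹ * π * sigma lam) = Equiv.Perm.sign π := by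
        simp only [Equiv.Perm.sign_mul, Equiv.Perm.sign_inv]
        rw [mul_comm (Equiv.Perm.sign (sigma lam)), mul_assoc, Int.units_mul_self, mul_one]
      rw [hs] at h
      have h2 := congr_arg (permAct k (parity m n) (sigma lam)⁻¹) h
      have h3 : (sigma lam)⁻¹ * π * sigma lam * (sigma lam)⁻¹ = (sigma lam)⁻¹ * π :=
        mul_inv_cancel_right _ _
      rw [← permAct_mul, h3, permAct_mul, Units.smul_def, map_zsmul,
        ← Units.smul_def] at h2
      rw [h2, smul_smul, Int.units_mul_self, one_smul]
    · rw [theta_apply, parityShift_parityShift]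
      exact congr_arg _ hy

theorem constr_wordBasis_apply {d : ℕ} (g : (Fin d → Fin m ⊕ Fin n) → k)
    (z : TensorPow k (Fin m ⊕ Fin n) d) :
    (wordBasis k (Fin m ⊕ Fin n) d).constr k g z =
      ∑ w, g w * (wordBasis k (Fin m ⊕ Fin n) d).repr z w := by
  rw [Module.Basis.constr_apply_fintype]
  exact Finset.sum_congr rfl fun w _ => mul_comm _ _

/-- The equivariant functionals detect the vanishing in the coinvariants. -/
theorem symMk_eq_zero_iff {d : ℕ} (b : Fin d → ℕ) (z : TensorPow k (Fin m ⊕ Fin n) d) :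
    symMk k m n b z = 0 ↔
      ∀ g : (Fin d → Fin m ⊕ Fin n) → k,
        Equivariant (superSign (parity m n)) (youngSubgroup b) g →
          ∑ w, g w * (wordBasis k (Fin m ⊕ Fin n) d).repr z w = 0 := by
  simp only [← constr_wordBasis_apply]
  have h1 : symMk k m n b z = 0 ↔ z ∈ symRelations k m n b := Submodule.Quotient.mk_eq_zero _
  rw [h1]
  constructor
  · intro hz g hg
    rw [symRelations, iSup_subtype'] at hz
    refine Submodule.iSup_induction _
      (motive := fun z => (wordBasis k (Fin m ⊕ Fin n) d).constr k g z = 0) hz ?_ (map_zero _)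
      fun x y hx hy => by rw [map_add, hx, hy, add_zero]
    rintro ⟨σ, hσ⟩ _ ⟨x, rfl⟩
    have h2 : (wordBasis k (Fin m ⊕ Fin n) d).constr k g ∘ₗ permAct k (parity m n) σ =
        (wordBasis k (Fin m ⊕ Fin n) d).constr k g := by
      refine (wordBasis k (Fin m ⊕ Fin n) d).ext fun w => ?_
      rw [LinearMap.comp_apply, permAct_wordBasis, Units.smul_def, map_zsmul,
        Module.Basis.constr_basis, Module.Basis.constr_basis, hg w σ hσ,
        ← Int.cast_smul_eq_zsmul k, smul_eq_mul, ← mul_assoc, intCast_units_mul_self, one_mul]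
    rw [LinearMap.sub_apply, map_sub, sub_eq_zero]
    exact LinearMap.congr_fun h2 x
  · intro h
    by_contra hz
    -- Some functional kills the relations but not `z`; its values on words are equivariant because
    -- it kills every x . σ - x.
    obtain ⟨f, hf, hker⟩ := Submodule.exists_le_ker_of_notMem
      (p := (symRelations k m n b).restrictScalars k) hz
    refine hf ?_
    rw [← h (fun w => f (wordBasis k (Fin m ⊕ Fin n) d w)) ?_]
    · exact LinearMap.congr_fun ((wordBasis k (Fin m ⊕ Fin n) d).ext fun w => by
        rw [Module.Basis.constr_basis]) z
    · intro w σ hσ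
      have h2 : permAct k (parity m n) σ (wordBasis k (Fin m ⊕ Fin n) d w) -
          wordBasis k (Fin m ⊕ Fin n) d w ∈ symRelations k m n b :=
        Submodule.mem_iSup_of_mem σ (Submodule.mem_iSup_of_mem hσ ⟨_, rfl⟩)
      have h3 : f _ = 0 := hker h2
      rw [map_sub, permAct_wordBasis, Units.smul_def, map_zsmul, ← Int.cast_smul_eq_zsmul k,
        smul_eq_mul, sub_eq_zero] at h3
      beta_reduce
      rw [← h3, ← mul_assoc, intCast_units_mul_self, one_mul]

end schur

/-! ### The semistandard basis and the formal character -/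

section character

/-- The rank of a letter in the order `X₁, …, X_m, Y₁, …, Y_n`. -/
def letterRank (m n : ℕ) : Fin m ⊕ Fin n → ℕ := fun a => finSumFinEquiv a

theorem letterRank_injective (m n : ℕ) : Function.Injective (letterRank m n) :=
  Fin.val_injective.comp finSumFinEquiv.injective

/-- The semistandard words of shape `lam` in the letters `X₁, …, X_m, Y₁, …, Y_n`. -/
abbrev SemistandardWord (m n : ℕ) (lam : YoungDiagram) : Type :=
  {S : Fin lam.card → Fin m ⊕ Fin n //
    Semistandard (parity m n) (letterRank m n) (rowBlock lam) (cellCol lam) S}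

open Classical in
noncomputable instance (m n : ℕ) (lam : YoungDiagram) : Fintype (SemistandardWord m n lam) :=
  Fintype.ofFinite _

variable (k : Type*) [Field k] (m n : ℕ) (lam : YoungDiagram)

/-- The twisted sum over the column orbit of a word. -/
noncomputable def orbitTensor (u : Fin lam.card → Fin m ⊕ Fin n) :
    TensorPow k (Fin m ⊕ Fin n) lam.card :=
  ∑ v, (orbitCoeff (twistedSign (parity m n)) (youngSubgroup (cellCol lam)) u v : k) •
    wordBasis k (Fin m ⊕ Fin n) lam.card v

variable {k m n lam}

theorem repr_orbitTensor (u v : Fin lam.card → Fin m ⊕ Fin n) :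
    (wordBasis k (Fin m ⊕ Fin n) lam.card).repr (orbitTensor k m n lam u) v =
      (orbitCoeff (twistedSign (parity m n)) (youngSubgroup (cellCol lam)) u v : k) := by
  rw [orbitTensor, Module.Basis.repr_sum_self]

theorem sum_orbitCoeff_mul_repr_orbitTensor (u v : Fin lam.card → Fin m ⊕ Fin n) :
    ∑ x, (orbitCoeff (superSign (parity m n)) (youngSubgroup (rowBlock lam)) u x : k) *
      (wordBasis k (Fin m ⊕ Fin n) lam.card).repr (orbitTensor k m n lam v) x =
        (orbitPairing (parity m n) (rowBlock lam) (cellCol lam) u v : k) := by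
  simp only [repr_orbitTensor, orbitPairing]
  push_cast
  rfl

theorem symMk_smul (c : k) (z : TensorPow k (Fin m ⊕ Fin n) lam.card) :
    symMk k m n (rowBlock lam) (c • z) = c • symMk k m n (rowBlock lam) z :=
  ((symMk k m n (rowBlock lam)).restrictScalars k).map_smul c z

/-- Testing a relation against the row orbit functions of semistandard words gives a linear system
whose matrix is the image in k of an integer matrix of determinant 1. -/
theorem linearIndependent_symMk_orbitTensor :
    LinearIndependent k fun S : SemistandardWord m n lam =>
      symMk k m n (rowBlock lam) (orbitTensor k m n lam S.1) := by
  classical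
  rw [Fintype.linearIndependent_iff]
  intro a ha
  have h1 : symMk k m n (rowBlock lam) (∑ S : SemistandardWord m n lam,
      a S • orbitTensor k m n lam S.1) = 0 := by
    rw [map_sum, ← ha]
    exact Finset.sum_congr rfl fun S _ => symMk_smul _ _
  rw [symMk_eq_zero_iff] at h1
  suffices h : a = 0 from fun S => congr_fun h S
  refine Matrix.eq_zero_of_mulVec_eq_zero (M := Matrix.map (Matrix.of
    fun u w : SemistandardWord m n lam => orbitPairing (parity m n) (rowBlock lam) (cellCol lam)
      u.1 w.1) (Int.castRingHom k)) ?_ ?_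
  · rw [← RingHom.mapMatrix_apply, ← RingHom.map_det,
      det_orbitPairing (letterRank_injective m n) rowReading_ext]
    simp
  · funext u
    have h2 := h1 _ (equivariant_orbitCoeff (superSign_mul (parity m n))
      (u.2.admissible_row rowReading_ext))
    simp only [map_sum, map_smul, Finsupp.finsetSum_apply, Finsupp.smul_apply, smul_eq_mul,
      Finset.mul_sum] at h2
    rw [Finset.sum_comm] at h2
    simp only [mul_left_comm _ (a _), ← Finset.mul_sum, sum_orbitCoeff_mul_repr_orbitTensor] at h2
    simp only [Matrix.mulVec, dotProduct, Matrix.map_apply, Matrix.of_apply, eq_intCast,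
      Pi.zero_apply]
    simpa only [mul_comm] using h2

/-- The integral straightening relation is cast to k. It holds in the coinvariants because it holds
on row orbit functions of admissible words, which span the equivariant functionals when 2 ≠ 0. -/
theorem symMk_orbitTensor_mem_span (hk : (2 : k) ≠ 0) {u : Fin lam.card → Fin m ⊕ Fin n}
    (hu : Admissible (twistedSign (parity m n)) (youngSubgroup (cellCol lam)) u) :
    symMk k m n (rowBlock lam) (orbitTensor k m n lam u) ∈ Submodule.span k (Set.range
      fun S : SemistandardWord m n lam =>
        symMk k m n (rowBlock lam) (orbitTensor k m n lam S.1)) := by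
  obtain ⟨q, hq⟩ := exists_orbitPairing_eq (letterRank_injective m n) hu
  suffices h : symMk k m n (rowBlock lam) (orbitTensor k m n lam u -
      ∑ S : SemistandardWord m n lam, (q S : k) • orbitTensor k m n lam S.1) = 0 by
    rw [map_sub, map_sum, sub_eq_zero] at h
    rw [h]
    refine Submodule.sum_mem _ fun S _ => ?_
    rw [symMk_smul]
    exact Submodule.smul_mem _ _ (Submodule.subset_span ⟨S, rfl⟩)
  rw [symMk_eq_zero_iff]
  intro g hg
  refine Submodule.span_induction (p := fun g _ => ∑ w, g w *
    (wordBasis k (Fin m ⊕ Fin n) lam.card).repr (orbitTensor k m n lam u -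
      ∑ S : SemistandardWord m n lam, (q S : k) • orbitTensor k m n lam S.1) w = 0) ?_ ?_ ?_ ?_
    (hg.mem_span hk (superSign_mul _))
  · rintro _ ⟨v, hv, rfl⟩
    simp only [map_sub, map_sum, map_smul, Finsupp.sub_apply, Finsupp.finsetSum_apply,
      Finsupp.smul_apply, smul_eq_mul, mul_sub, Finset.sum_sub_distrib, Finset.mul_sum]
    rw [Finset.sum_comm (s := Finset.univ) (t := Finset.univ (α := SemistandardWord m n lam))]
    simp only [mul_left_comm _ (q _ : k), ← Finset.mul_sum, sum_orbitCoeff_mul_repr_orbitTensor]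
    rw [hq v hv]
    push_cast
    exact sub_self _
  · simp
  · intro x y _ _ hx hy
    simp only [Pi.add_apply, add_mul, Finset.sum_add_distrib, hx, hy, add_zero]
  · intro c x _ hx
    simp only [Pi.smul_apply, smul_eq_mul, mul_assoc, ← Finset.mul_sum, hx, mul_zero]

theorem restrictScalars_schurSupermodule (hk : (2 : k) ≠ 0) :
    (SchurSupermodule k m n lam).restrictScalars k = Submodule.span k (Set.range
      fun S : SemistandardWord m n lam =>
        symMk k m n (rowBlock lam) (orbitTensor k m n lam S.1)) := by
  refine le_antisymm (fun y hy => ?_) (Submodule.span_le.2 ?_)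
  swap
  · rintro _ ⟨S, rfl⟩
    refine (mem_schurSupermodule_iff _).2 ⟨_, fun w σ hσ => ?_, rfl⟩
    rw [repr_orbitTensor, repr_orbitTensor]
    exact equivariant_orbitCoeff (k := k) (twistedSign_mul (parity m n))
      (S.2.admissible_col rowReading_ext) w σ hσ
  obtain ⟨z, hz, rfl⟩ := (mem_schurSupermodule_iff y).1 hy
  let T : ((Fin lam.card → Fin m ⊕ Fin n) → k) →ₗ[k] SymPow k m n (rowBlock lam) :=
    (symMk k m n (rowBlock lam)).restrictScalars k ∘ₗ
      (wordBasis k (Fin m ⊕ Fin n) lam.card).equivFun.symm.toLinearMap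
  have hT : symMk k m n (rowBlock lam) z =
      T ((wordBasis k (Fin m ⊕ Fin n) lam.card).repr z) := by
    refine congr_arg (symMk k m n (rowBlock lam)) ?_
    exact ((wordBasis k (Fin m ⊕ Fin n) lam.card).equivFun.symm_apply_apply z).symm
  rw [hT]
  have h2 := Submodule.mem_map_of_mem (f := T) (hz.mem_span hk (twistedSign_mul _))
  rw [Submodule.map_span] at h2
  refine Submodule.span_le.2 ?_ h2
  rintro _ ⟨_, ⟨u, hu, rfl⟩, rfl⟩
  have h3 : (wordBasis k (Fin m ⊕ Fin n) lam.card).equivFun.symm (fun v =>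
      (orbitCoeff (twistedSign (parity m n)) (youngSubgroup (cellCol lam)) u v : k)) =
      orbitTensor k m n lam u := Module.Basis.equivFun_symm_apply _ _
  have h4 := symMk_orbitTensor_mem_span hk hu
  rw [← h3] at h4
  exact h4

theorem wordWeight_comp {d : ℕ} (w : Fin d → Fin m ⊕ Fin n) (σ : Equiv.Perm (Fin d)) :
    wordWeight (w ∘ σ) = wordWeight w :=
  Equiv.sum_comp σ fun r => Finsupp.single (w r) 1

theorem weightIdempotent_smul_orbitTensor (μ : Fin m ⊕ Fin n →₀ ℕ)
    (u : Fin lam.card → Fin m ⊕ Fin n) :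
    weightIdempotent k m n lam.card μ • orbitTensor k m n lam u =
      if wordWeight u = μ then orbitTensor k m n lam u else 0 := by
  change (∑ w : Fin lam.card → Fin m ⊕ Fin n with wordWeight w = μ, diagonalUnit k w)
    (orbitTensor k m n lam u) = _
  have h : ∀ v, (orbitCoeff (twistedSign (parity m n)) (youngSubgroup (cellCol lam)) u v : k) •
      (∑ w : Fin lam.card → Fin m ⊕ Fin n with wordWeight w = μ, diagonalUnit k w)
        (wordBasis k (Fin m ⊕ Fin n) lam.card v) = if wordWeight u = μ then
      (orbitCoeff (twistedSign (parity m n)) (youngSubgroup (cellCol lam)) u v : k) •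
        wordBasis k (Fin m ⊕ Fin n) lam.card v else 0 := by
    intro v
    by_cases h0 : orbitCoeff (twistedSign (parity m n)) (youngSubgroup (cellCol lam)) u v = 0
    · simp [h0]
    obtain ⟨σ, -, rfl⟩ := exists_of_orbitCoeff_ne_zero h0
    rw [sum_diagonalUnit_wordBasis, wordWeight_comp]
    split_ifs
    · rfl
    · exact smul_zero _
  rw [orbitTensor, map_sum]
  simp only [map_smul, h]
  split_ifs <;> simp

theorem map_span_of_diagonal {W I : Type*} [AddCommGroup W] [Module k W] (w : I → W)
    (P : I → Prop) [DecidablePred P] (f : W →ₗ[k] W) (hf : ∀ i, f (w i) = if P i then w i else 0) :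
    (Submodule.span k (Set.range w)).map f =
      Submodule.span k (Set.range fun i : {i // P i} => w i) := by
  rw [Submodule.map_span]
  apply le_antisymm <;> rw [Submodule.span_le]
  · rintro _ ⟨_, ⟨i, rfl⟩, rfl⟩
    rw [hf]
    split_ifs with hi
    · exact Submodule.subset_span ⟨⟨i, hi⟩, rfl⟩
    · exact Submodule.zero_mem _
  · rintro _ ⟨⟨i, hi⟩, rfl⟩
    exact Submodule.subset_span ⟨w i, ⟨i, rfl⟩, by rw [hf, if_pos hi]⟩

/-- The formal character of a supermodule embedded as the span of independent weight vectors. -/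
theorem formalCharacter_eq_sum {d : ℕ} {V W I : Type*} [AddCommGroup V] [Module k V]
    [Module (SchurSuperalgebra k m n d) V] [IsScalarTower k (SchurSuperalgebra k m n d) V]
    [Module.Finite k V] [AddCommGroup W] [Module k W] [Module (SchurSuperalgebra k m n d) W]
    [IsScalarTower k (SchurSuperalgebra k m n d) W] [Fintype I]
    (j : V →ₗ[SchurSuperalgebra k m n d] W) (hj : Function.Injective j) (w : I → W)
    (hw : LinearIndependent k w)
    (hrange : LinearMap.range (j.restrictScalars k) = Submodule.span k (Set.range w))
    (wt : I → Fin m ⊕ Fin n →₀ ℕ) (hwt : ∀ i, ∑ a, wt i a = d)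
    (hE : ∀ μ i, weightIdempotent k m n d μ • w i = if wt i = μ then w i else 0) :
    formalCharacter k m n d V = ∑ i, MvPolynomial.monomial (wt i) 1 := by
  rw [formalCharacter, ← Finset.sum_fiberwise_of_maps_to
    (t := Finset.finsuppAntidiag Finset.univ d) (g := wt)]
  · refine Finset.sum_congr rfl fun μ _ => ?_
    have h1 : (weightSpace k m n d V μ).map (j.restrictScalars k) =
        Submodule.span k (Set.range fun i : {i // wt i = μ} => w i) := by
      rw [weightSpace, ← LinearMap.range_comp, ← map_span_of_diagonal w (fun i => wt i = μ)
        (Algebra.lsmul k k W (weightIdempotent k m n d μ)) fun i => hE μ i, ← hrange,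
        ← LinearMap.range_comp]
      congr 1
      ext x
      exact j.map_smul _ x
    have hinj : Function.Injective (j.restrictScalars k) := hj
    rw [(Submodule.equivMapOfInjective _ hinj (weightSpace k m n d V μ)).finrank_eq, h1]
    have h2 := finrank_span_eq_card (hw.comp (fun i : {i // wt i = μ} => i.1)
      Subtype.val_injective)
    rw [Function.comp_def] at h2
    rw [h2, Fintype.card_subtype, Finset.sum_congr rfl fun S hS => by
      rw [(Finset.mem_filter.1 hS).2], Finset.sum_const, ← map_nsmul]
    simp
  · intro i _
    rw [Finset.mem_finsuppAntidiag]
    exact ⟨hwt i, Finset.subset_univ _⟩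

theorem sum_wordWeight {d : ℕ} (w : Fin d → Fin m ⊕ Fin n) : ∑ a, wordWeight w a = d := by
  simp only [wordWeight, Finsupp.finsetSum_apply]
  rw [Finset.sum_comm]
  simp [Finsupp.single_apply]

theorem prod_X_eq_monomial {d : ℕ} (w : Fin d → Fin m ⊕ Fin n) :
    ∏ r, (MvPolynomial.X (w r) : MvPolynomial (Fin m ⊕ Fin n) ℤ) =
      MvPolynomial.monomial (wordWeight w) 1 := by
  rw [wordWeight, MvPolynomial.monomial_sum_one]
  rfl

/-- The character of the Schur supermodule is the generating function of semistandard words. -/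
theorem formalCharacter_schurSupermodule (hk : (2 : k) ≠ 0) :
    formalCharacter k m n lam.card (SchurSupermodule k m n lam) =
      ∑ S : SemistandardWord m n lam, ∏ r, MvPolynomial.X (S.1 r) := by
  simp only [prod_X_eq_monomial]
  refine formalCharacter_eq_sum (SchurSupermodule k m n lam).subtype Subtype.val_injective
    (fun S : SemistandardWord m n lam => symMk k m n (rowBlock lam) (orbitTensor k m n lam S.1))
    linearIndependent_symMk_orbitTensor ?_ (fun S => wordWeight S.1)
    (fun S => sum_wordWeight S.1) fun μ S => ?_
  · rw [← restrictScalars_schurSupermodule hk]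
    ext x
    exact ⟨fun ⟨y, h⟩ => h ▸ y.2, fun h => ⟨⟨x, h⟩, rfl⟩⟩
  · rw [← map_smul, weightIdempotent_smul_orbitTensor]
    split_ifs
    · rfl
    · exact map_zero _

end character

/-! ### Semistandard words as pairs of tableaux, and the hook Schur function -/

section tableaux

variable {m n : ℕ} {lam mu : YoungDiagram}

theorem mem_cells_sdiff_bot {c : ℕ × ℕ} :
    c ∈ mu.cells \ (⊥ : YoungDiagram).cells ↔ c ∈ mu.cells := by
  simp

theorem mem_transpose_sdiff {c : ℕ × ℕ} :
    c ∈ lam.transpose.cells \ mu.transpose.cells ↔ c.swap ∈ lam.cells ∧ c.swap ∉ mu.cells := by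
  simp [Finset.mem_sdiff, YoungDiagram.mem_transpose]

open Classical in
/-- The word of shape `lam` filled with the even letters `T₁` on `mu` and the odd letters `T₂`
outside `mu`. -/
noncomputable def hookFilling (T₁ : (mu.cells \ (⊥ : YoungDiagram).cells : Finset (ℕ × ℕ)) → Fin m)
    (T₂ : (lam.transpose.cells \ mu.transpose.cells : Finset (ℕ × ℕ)) → Fin n)
    (r : Fin lam.card) : Fin m ⊕ Fin n :=
  if h : (rowReading lam r).1 ∈ mu.cells then
    Sum.inl (T₁ ⟨(rowReading lam r).1, mem_cells_sdiff_bot.2 h⟩)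
  else Sum.inr (T₂ ⟨(rowReading lam r).1.swap, mem_transpose_sdiff.2 ⟨(rowReading lam r).2, h⟩⟩)

variable {T₁ : (mu.cells \ (⊥ : YoungDiagram).cells : Finset (ℕ × ℕ)) → Fin m}
  {T₂ : (lam.transpose.cells \ mu.transpose.cells : Finset (ℕ × ℕ)) → Fin n}

theorem prod_hookFilling (hmu : mu ≤ lam) :
    ∏ r, (MvPolynomial.X (hookFilling T₁ T₂ r) : MvPolynomial (Fin m ⊕ Fin n) ℤ) =
      (∏ c, MvPolynomial.X (Sum.inl (T₁ c))) * ∏ c, MvPolynomial.X (Sum.inr (T₂ c)) := by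
  classical
  -- The variable at each cell, extended by 1 outside λ, makes all three products run over finite
  -- sets of cells.
  let h : ℕ × ℕ → MvPolynomial (Fin m ⊕ Fin n) ℤ := fun c =>
    if h : c ∈ mu.cells then MvPolynomial.X (Sum.inl (T₁ ⟨c, mem_cells_sdiff_bot.2 h⟩))
    else if h' : c ∈ lam.cells then
      MvPolynomial.X (Sum.inr (T₂ ⟨c.swap, mem_transpose_sdiff.2 ⟨h', h⟩⟩))
    else 1
  have h1 : ∏ r, (MvPolynomial.X (hookFilling T₁ T₂ r) : MvPolynomial (Fin m ⊕ Fin n) ℤ) =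
      ∏ c ∈ lam.cells, h c := by
    rw [← Finset.prod_coe_sort lam.cells h, ← Equiv.prod_comp (rowReading lam) fun c => h c.1]
    refine Finset.prod_congr rfl fun r _ => ?_
    by_cases hr : (rowReading lam r).1 ∈ mu.cells
    · simp only [hookFilling, h, dif_pos hr]
    · simp only [hookFilling, h, dif_neg hr, dif_pos (rowReading lam r).2]
  have h2 : ∏ c, (MvPolynomial.X (Sum.inl (T₁ c)) : MvPolynomial (Fin m ⊕ Fin n) ℤ) =
      ∏ c ∈ mu.cells, h c := by
    rw [← Finset.prod_congr (show mu.cells \ (⊥ : YoungDiagram).cells = mu.cells by simp)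
      fun _ _ => rfl, ← Finset.prod_coe_sort _ h]
    refine Finset.prod_congr rfl fun c _ => ?_
    simp only [h, dif_pos (mem_cells_sdiff_bot.1 c.2)]
  have h3 : ∏ c, (MvPolynomial.X (Sum.inr (T₂ c)) : MvPolynomial (Fin m ⊕ Fin n) ℤ) =
      ∏ c ∈ lam.cells \ mu.cells, h c := by
    trans ∏ c ∈ lam.transpose.cells \ mu.transpose.cells, h c.swap
    · rw [← Finset.prod_coe_sort _ fun c : ℕ × ℕ => h c.swap]
      refine Finset.prod_congr rfl fun c _ => ?_
      obtain ⟨h4, h5⟩ := mem_transpose_sdiff.1 c.2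
      simp only [h, dif_neg h5, dif_pos h4, Prod.swap_swap]
    · refine Finset.prod_bij' (fun c _ => c.swap) (fun c _ => c.swap) ?_ ?_ ?_ ?_ ?_
      · intro c hc
        exact Finset.mem_sdiff.2 (mem_transpose_sdiff.1 hc)
      · intro c hc
        rw [mem_transpose_sdiff, Prod.swap_swap]
        exact Finset.mem_sdiff.1 hc
      all_goals simp
  rw [h1, h2, h3, mul_comm, Finset.prod_sdiff hmu]

theorem inl_lt_inr (a : Fin m) (b : Fin n) :
    letterRank m n (Sum.inl a) < letterRank m n (Sum.inr b) := by
  simp only [letterRank, finSumFinEquiv_apply_left, finSumFinEquiv_apply_right, Fin.val_castAdd,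
    Fin.val_natAdd]
  omega

theorem inl_lt_inl {a b : Fin m} :
    letterRank m n (Sum.inl a) < letterRank m n (Sum.inl b) ↔ a < b := by
  simp [letterRank]

theorem inr_lt_inr {a b : Fin n} :
    letterRank m n (Sum.inr a) < letterRank m n (Sum.inr b) ↔ a < b := by
  simp [letterRank]

theorem hookFilling_of_mem {r : Fin lam.card} (h : (rowReading lam r).1 ∈ mu.cells) :
    hookFilling T₁ T₂ r = Sum.inl (T₁ ⟨(rowReading lam r).1, mem_cells_sdiff_bot.2 h⟩) :=
  dif_pos h

theorem hookFilling_of_notMem {r : Fin lam.card} (h : (rowReading lam r).1 ∉ mu.cells) :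
    hookFilling T₁ T₂ r = Sum.inr (T₂ ⟨(rowReading lam r).1.swap,
      mem_transpose_sdiff.2 ⟨(rowReading lam r).2, h⟩⟩) :=
  dif_neg h

theorem exists_rowReading_eq {c : ℕ × ℕ} (hc : c ∈ lam.cells) : ∃ r, (rowReading lam r).1 = c :=
  ⟨(rowReading lam).symm ⟨c, hc⟩, by rw [Equiv.apply_symm_apply]⟩

theorem exists_rowReading_swap_eq {c : ℕ × ℕ}
    (hc : c ∈ lam.transpose.cells \ mu.transpose.cells) :
    ∃ r, (rowReading lam r).1.swap = c ∧ (rowReading lam r).1 ∉ mu.cells := by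
  obtain ⟨h1, h2⟩ := mem_transpose_sdiff.1 hc
  obtain ⟨r, hr⟩ := exists_rowReading_eq h1
  exact ⟨r, by rw [hr, Prod.swap_swap], hr ▸ h2⟩

/-- Odd letters outrank even ones and μ is a lower set, so comparisons between μ and its complement
hold automatically. On the complement, transposition exchanges the strict and weak directions. -/
theorem semistandard_hookFilling_iff (hmu : mu ≤ lam) :
    Semistandard (parity m n) (letterRank m n) (rowBlock lam) (cellCol lam)
      (hookFilling T₁ T₂) ↔
        T₁ ∈ skewTableaux m mu ⊥ ∧ T₂ ∈ skewTableaux n lam.transpose mu.transpose := by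
  have hlower : ∀ r s, (rowReading lam s).1 ∈ mu.cells → rowBlock lam r ≤ rowBlock lam s →
      cellCol lam r ≤ cellCol lam s → (rowReading lam r).1 ∈ mu.cells :=
    fun r s hs h1 h2 => mu.isLowerSet (Prod.mk_le_mk.2 ⟨h1, h2⟩) hs
  constructor
  · rintro ⟨hrow, hcol⟩
    refine ⟨⟨?_, ?_⟩, ?_, ?_⟩
    · rintro ⟨c, hc⟩ ⟨c', hc'⟩ h h'
      obtain ⟨r, rfl⟩ := exists_rowReading_eq (hmu (mem_cells_sdiff_bot.1 hc))
      obtain ⟨s, rfl⟩ := exists_rowReading_eq (hmu (mem_cells_sdiff_bot.1 hc'))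
      have h1 := hrow r s h h'
      rw [hookFilling_of_mem (mem_cells_sdiff_bot.1 hc),
        hookFilling_of_mem (mem_cells_sdiff_bot.1 hc'), inl_lt_inl] at h1
      rcases h1 with h1 | h1
      · exact h1.le
      · exact (Sum.inl_injective h1.1).le
    · rintro ⟨c, hc⟩ ⟨c', hc'⟩ h h'
      obtain ⟨r, rfl⟩ := exists_rowReading_eq (hmu (mem_cells_sdiff_bot.1 hc))
      obtain ⟨s, rfl⟩ := exists_rowReading_eq (hmu (mem_cells_sdiff_bot.1 hc'))
      have h1 := hcol r s h h'
      rw [hookFilling_of_mem (mem_cells_sdiff_bot.1 hc),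
        hookFilling_of_mem (mem_cells_sdiff_bot.1 hc'), inl_lt_inl] at h1
      exact h1.resolve_right fun h2 => h2.2 rfl
    · rintro ⟨c, hc⟩ ⟨c', hc'⟩ h h'
      obtain ⟨r, rfl, hr⟩ := exists_rowReading_swap_eq hc
      obtain ⟨s, rfl, hs⟩ := exists_rowReading_swap_eq hc'
      have h1 := hcol r s h h'
      rw [hookFilling_of_notMem hr, hookFilling_of_notMem hs, inr_lt_inr] at h1
      rcases h1 with h1 | h1
      · exact h1.le
      · exact (Sum.inr_injective h1.1).le
    · rintro ⟨c, hc⟩ ⟨c', hc'⟩ h h'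
      obtain ⟨r, rfl, hr⟩ := exists_rowReading_swap_eq hc
      obtain ⟨s, rfl, hs⟩ := exists_rowReading_swap_eq hc'
      have h1 := hrow r s h h'
      rw [hookFilling_of_notMem hr, hookFilling_of_notMem hs, inr_lt_inr] at h1
      exact h1.resolve_right fun h2 => one_ne_zero h2.2
  · rintro ⟨⟨h1, h2⟩, h3, h4⟩
    constructor
    · intro r s h h'
      by_cases hs : (rowReading lam s).1 ∈ mu.cells
      · have hr := hlower r s hs h.le h'.le
        rw [hookFilling_of_mem hr, hookFilling_of_mem hs, inl_lt_inl]
        rcases (h1 ⟨_, mem_cells_sdiff_bot.2 hr⟩ ⟨_, mem_cells_sdiff_bot.2 hs⟩ h h').lt_or_eq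
          with h5 | h5
        · exact Or.inl h5
        · exact Or.inr ⟨congr_arg _ h5, rfl⟩
      · left
        by_cases hr : (rowReading lam r).1 ∈ mu.cells
        · rw [hookFilling_of_mem hr, hookFilling_of_notMem hs]
          exact inl_lt_inr _ _
        · rw [hookFilling_of_notMem hr, hookFilling_of_notMem hs, inr_lt_inr]
          exact h4 _ _ h h'
    · intro r s h h'
      by_cases hs : (rowReading lam s).1 ∈ mu.cells
      · have hr := hlower r s hs h'.le h.le
        rw [hookFilling_of_mem hr, hookFilling_of_mem hs, inl_lt_inl]
        exact Or.inl (h2 _ _ h h')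
      · by_cases hr : (rowReading lam r).1 ∈ mu.cells
        · rw [hookFilling_of_mem hr, hookFilling_of_notMem hs]
          exact Or.inl (inl_lt_inr _ _)
        · rw [hookFilling_of_notMem hr, hookFilling_of_notMem hs, inr_lt_inr]
          rcases (h3 ⟨(rowReading lam r).1.swap, mem_transpose_sdiff.2 ⟨(rowReading lam r).2, hr⟩⟩
            ⟨(rowReading lam s).1.swap, mem_transpose_sdiff.2 ⟨(rowReading lam s).2, hs⟩⟩
            h h').lt_or_eq with h5 | h5
          · exact Or.inl h5
          · exact Or.inr ⟨congr_arg _ h5, one_ne_zero⟩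

/-- The comparison passes through the cell in the row of `r` and the column of `s`, which lies in
the diagram. -/
theorem Semistandard.le {S : Fin lam.card → Fin m ⊕ Fin n}
    (hS : Semistandard (parity m n) (letterRank m n) (rowBlock lam) (cellCol lam) S)
    {r s : Fin lam.card} (h : rowBlock lam r ≤ rowBlock lam s)
    (h' : cellCol lam r ≤ cellCol lam s) : letterRank m n (S r) ≤ letterRank m n (S s) := by
  obtain ⟨t, h1, h2⟩ := exists_position (lam.up_left_mem h le_rfl (mem_of_position s))
  trans letterRank m n (S t)
  · rcases (h'.trans_eq h2.symm).eq_or_lt with h3 | h3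
    · rw [rowReading_ext r t h1.symm h3]
    · exact hS.row_le r t h1.symm h3
  · rcases (h1.trans_le h).eq_or_lt with h3 | h3
    · rw [rowReading_ext t s h3 h2]
    · exact hS.col_le t s h2 h3

/-- The cells of a semistandard word that hold even letters. -/
def evenShape (S : SemistandardWord m n lam) : YoungDiagram where
  cells := (Finset.univ.filter fun r => (S.1 r).isLeft).image fun r => (rowReading lam r).1
  isLowerSet := by
    intro c c' hle hc
    simp only [Finset.coe_image, Set.mem_image, Finset.mem_coe, Finset.mem_filter, Finset.mem_univ,
      true_and] at hc ⊢
    obtain ⟨s, hs, rfl⟩ := hc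
    obtain ⟨r, rfl⟩ := exists_rowReading_eq (lam.isLowerSet hle (rowReading lam s).2)
    refine ⟨r, ?_, rfl⟩
    have h := S.2.le (r := r) (s := s) hle.1 hle.2
    rcases hr : S.1 r with a | a
    · rfl
    · rcases hs' : S.1 s with b | b
      · rw [hr, hs'] at h
        exact absurd h (inl_lt_inr b a).not_ge
      · rw [hs'] at hs
        exact absurd hs (by simp)

theorem mem_evenShape {S : SemistandardWord m n lam} {r : Fin lam.card} :
    (rowReading lam r).1 ∈ (evenShape S).cells ↔ (S.1 r).isLeft := by
  have hinj : Function.Injective fun r => (rowReading lam r).1 :=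
    Subtype.val_injective.comp (rowReading lam).injective
  simp only [evenShape, Finset.mem_image, Finset.mem_filter, Finset.mem_univ, true_and]
  exact ⟨fun ⟨s, hs, h⟩ => hinj h ▸ hs, fun h => ⟨r, h, rfl⟩⟩

theorem evenShape_le (S : SemistandardWord m n lam) : evenShape S ≤ lam := by
  intro c hc
  obtain ⟨r, -, rfl⟩ := Finset.mem_image.1 ((YoungDiagram.mem_cells _).2 hc)
  exact (rowReading lam r).2

theorem evenShape_hookFilling (hmu : mu ≤ lam)
    (h : Semistandard (parity m n) (letterRank m n) (rowBlock lam) (cellCol lam)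
      (hookFilling T₁ T₂)) : evenShape ⟨hookFilling T₁ T₂, h⟩ = mu := by
  ext c
  constructor
  · intro hc
    obtain ⟨r, rfl⟩ := exists_rowReading_eq (evenShape_le _ hc)
    by_contra hr
    have h1 := mem_evenShape.1 hc
    simp only [hookFilling_of_notMem hr, Sum.isLeft_inr, Bool.false_eq_true] at h1
  · intro hc
    obtain ⟨r, rfl⟩ := exists_rowReading_eq (hmu hc)
    refine mem_evenShape.2 ?_
    simp only [hookFilling_of_mem hc, Sum.isLeft_inl]

theorem exists_hookFilling_eq (S : SemistandardWord m n lam) (hS : evenShape S = mu) :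
    ∃ (T₁ : (mu.cells \ (⊥ : YoungDiagram).cells : Finset (ℕ × ℕ)) → Fin m)
      (T₂ : (lam.transpose.cells \ mu.transpose.cells : Finset (ℕ × ℕ)) → Fin n),
      hookFilling T₁ T₂ = S.1 := by
  subst hS
  have h1 : ∀ c : ((evenShape S).cells \ (⊥ : YoungDiagram).cells : Finset (ℕ × ℕ)),
      ∃ a, ∀ r, (rowReading lam r).1 = c.1 → S.1 r = Sum.inl a := by
    rintro ⟨c, hc⟩
    rw [mem_cells_sdiff_bot] at hc
    obtain ⟨r, rfl⟩ := exists_rowReading_eq (evenShape_le _ hc)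
    obtain ⟨a, ha⟩ := Sum.isLeft_iff.1 (mem_evenShape.1 hc)
    exact ⟨a, fun s hs => by rw [(rowReading lam).injective (Subtype.ext hs), ha]⟩
  have h2 : ∀ c : (lam.transpose.cells \ (evenShape S).transpose.cells : Finset (ℕ × ℕ)),
      ∃ a, ∀ r, (rowReading lam r).1.swap = c.1 → S.1 r = Sum.inr a := by
    rintro ⟨c, hc⟩
    obtain ⟨r, rfl, hr⟩ := exists_rowReading_swap_eq hc
    rw [mem_evenShape, Bool.not_eq_true, Sum.isLeft_eq_false] at hr
    obtain ⟨a, ha⟩ := Sum.isRight_iff.1 hr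
    exact ⟨a, fun s hs => by
      rw [(rowReading lam).injective (Subtype.ext (Prod.swap_injective hs)), ha]⟩
  choose T₁ hT₁ using h1
  choose T₂ hT₂ using h2
  refine ⟨T₁, T₂, funext fun r => ?_⟩
  by_cases hr : (rowReading lam r).1 ∈ (evenShape S).cells
  · rw [hookFilling_of_mem hr]
    exact (hT₁ _ r rfl).symm
  · rw [hookFilling_of_notMem hr]
    exact (hT₂ _ r rfl).symm

theorem hookFilling_injective (hmu : mu ≤ lam)
    {T₁' : (mu.cells \ (⊥ : YoungDiagram).cells : Finset (ℕ × ℕ)) → Fin m}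
    {T₂' : (lam.transpose.cells \ mu.transpose.cells : Finset (ℕ × ℕ)) → Fin n}
    (h : hookFilling T₁ T₂ = hookFilling T₁' T₂') : T₁ = T₁' ∧ T₂ = T₂' := by
  constructor
  · funext ⟨c, hc⟩
    obtain ⟨r, rfl⟩ := exists_rowReading_eq (hmu (mem_cells_sdiff_bot.1 hc))
    have h1 := congr_fun h r
    rw [hookFilling_of_mem (mem_cells_sdiff_bot.1 hc),
      hookFilling_of_mem (mem_cells_sdiff_bot.1 hc)] at h1
    exact Sum.inl_injective h1
  · funext ⟨c, hc⟩
    obtain ⟨r, rfl, hr⟩ := exists_rowReading_swap_eq hc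
    have h1 := congr_fun h r
    rw [hookFilling_of_notMem hr, hookFilling_of_notMem hr] at h1
    exact Sum.inr_injective h1

/-- The hook Schur function is the generating function of semistandard words. -/
theorem hookSchur_eq_sum (m n : ℕ) (lam : YoungDiagram) :
    hookSchur m n lam = ∑ S : SemistandardWord m n lam, ∏ r, MvPolynomial.X (S.1 r) := by
  classical
  -- The words are grouped by the subdiagram of their even letters.
  rw [hookSchur, ← Finset.sum_fiberwise_of_maps_to
    (t := (finite_subdiagrams lam).toFinset) (g := evenShape) fun S _ => by
      simpa using evenShape_le S]
  refine Finset.sum_congr rfl fun mu hmu => ?_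
  replace hmu : mu ≤ lam := by simpa using hmu
  rw [schur, skewSchur, skewSchur, map_sum, map_sum, Finset.sum_mul_sum, ← Finset.sum_product']
  refine Finset.sum_bij (fun T hT => ⟨hookFilling T.1 T.2,
    (semistandard_hookFilling_iff hmu).2 (by simpa using hT)⟩) ?_ ?_ ?_ ?_
  · intro T hT
    exact Finset.mem_filter.2 ⟨Finset.mem_univ _, evenShape_hookFilling hmu _⟩
  · intro T _ T' _ h
    obtain ⟨h1, h2⟩ := hookFilling_injective hmu (congr_arg Subtype.val h)
    exact Prod.ext h1 h2
  · intro S hS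
    obtain ⟨T₁, T₂, h⟩ := exists_hookFilling_eq S (Finset.mem_filter.1 hS).2
    have h1 := (semistandard_hookFilling_iff hmu).1 (h.symm ▸ S.2)
    exact ⟨(T₁, T₂), by simpa using h1, Subtype.ext h⟩
  · intro T _
    rw [prod_hookFilling hmu, map_prod, map_prod]
    simp only [MvPolynomial.rename_X]

end tableaux

end SchurSuper

theorem mainTheorem5 (k : Type*) [Field k] (hk : ringChar k ≠ 2) (m n : ℕ) (lam : YoungDiagram) :
    SchurSuper.formalCharacter k m n lam.card (SchurSuper.SchurSupermodule k m n lam) =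
      SchurSuper.hookSchur m n lam := by
  rw [SchurSuper.formalCharacter_schurSupermodule (Ring.two_ne_zero hk),
    SchurSuper.hookSchur_eq_sum]
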